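/- Let $\Psi:\mathbb R\to[0,\infty)$ be a Young function, i.e. a non-negative convex function on $\mathbb R$ which vanishes only at $0$ (symmetry is not assumed), and let $\lambda>0$. Let $\mu_\lambda$ be the probability measure on $\mathbb R$ \[ \mu_\lambda(dt)=\frac{1}{Z_\lambda}e^{-\lambda\Psi(t)}\,dt,\qquad Z_\lambda=\int_{\mathbb R}e^{-\lambda\Psi(t)}\,dt, \] and put $m_\lambda=\mathbb E\,\Psi(X)$ and $\sigma_\lambda=\sqrt{\mathrm{Var}(\Psi(X))}$, where $X$ has law $\mu_\lambda$. Let $(\alpha_n)_{n\ge1}$ be a bounded real sequence and $E_n=m_\lambda n+\alpha_n\sigma_\lambda\sqrt n$. For all sufficiently large $n$ (so that the following set has positive volume), let the random vector $\xi^{(n)}=(\xi^{(n)}_1,\dots,\xi^{(n)}_n)$ be uniformly distributed on the Orlicz ball \[ B^n_{\Psi/E_n}=\Big\{x\in\mathbb R^n:\ \sum_{i=1}^n\Psi(x_i)\le E_n\Big\}. \] Then for every sequence $(k_n)$ of non-negative integers with $k_n=o(\sqrt n)$ as $n\to\infty$ (so that $k_n\le n$ for all large $n$), \[ \lim_{n\to\infty}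 d_{TV}\big((\xi^{(n)}_1,\dots,\xi^{(n)}_{k_n}),\ \mu_\lambda^{\otimes k_n}\big)=0, \] where $d_{TV}$ is the total variation distance, $\sup_A|\mu(A)-\nu(A)|$ over Borel sets $A$, between the law of $(\xi^{(n)}_1,\dots,\xi^{(n)}_{k_n})$ and the product measure. -/

import Mathlib

open MeasureTheory ProbabilityTheory Filter Topology Asymptotics

/-- A Young function: a non-negative convex function on `ℝ` which vanishes only at `0`
(no symmetry is assumed). -/
structure IsYoungFunction (Ψ : ℝ → ℝ) : Prop where
  nonneg : ∀ t, 0 ≤ Ψ t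
  convexOn : ConvexOn ℝ Set.univ Ψ
  eq_zero_iff : ∀ t, Ψ t = 0 ↔ t = 0

/-- The `n`-dimensional Orlicz ball of `Ψ / E`, i.e. the set of `x ∈ ℝⁿ` with
`Ψ(x₁) + ⋯ + Ψ(xₙ) ≤ E`. -/
def orliczBall (Ψ : ℝ → ℝ) (E : ℝ) (n : ℕ) : Set (Fin n → ℝ) :=
  {x | ∑ i, Ψ (x i) ≤ E}

/-- The normalization constant `Z_lam = ∫ exp (-lam Ψ(t)) dt`. -/
noncomputable def orliczZ (Ψ : ℝ → ℝ) (lam : ℝ) : ℝ :=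
  ∫ t, Real.exp (-lam * Ψ t)

/-- The measure `μ_lam(dt) = exp (-lam Ψ(t)) dt / Z_lam` on `ℝ`. -/
noncomputable def orliczMeasure (Ψ : ℝ → ℝ) (lam : ℝ) : Measure ℝ :=
  volume.withDensity fun t => ENNReal.ofReal (Real.exp (-lam * Ψ t) / orliczZ Ψ lam)

/-- The mean `m_lam = 𝔼 Ψ(X)`, where `X` has law `μ_lam`. -/
noncomputable def orliczMean (Ψ : ℝ → ℝ) (lam : ℝ) : ℝ :=
  ∫ t, Ψ t ∂(orliczMeasure Ψ lam)

/-- The standard deviation `σ_lam = (Var Ψ(X))^(1/2)`, where `X` has law `μ_lam`. -/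
noncomputable def orliczSigma (Ψ : ℝ → ℝ) (lam : ℝ) : ℝ :=
  √(variance Ψ (orliczMeasure Ψ lam))

/-- The total variation distance `sup_A |μ(A) - ν(A)|` over measurable sets `A`
(for two probability measures; with densities, half of the `L¹` distance of the densities). -/
noncomputable def tvDist {X : Type*} [MeasurableSpace X] (μ ν : Measure X) : ℝ :=
  ⨆ A : {A : Set X // MeasurableSet A}, |μ.real A - ν.real A|

/-- The first `k` coordinates of `x ∈ ℝⁿ`, for `k ≤ n` (for `k > n`, a case which is
irrelevant in limits `n → ∞` with `k = o(√n)`, the missing coordinates are set to `0`). -/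
def firstCoords {n : ℕ} (k : ℕ) (x : Fin n → ℝ) : Fin k → ℝ :=
  fun i => if h : (i : ℕ) < n then x ⟨i, h⟩ else 0

/-!
Let `S = Ψ(X₁) + ⋯ + Ψ(Xₙ)` for independent `Xᵢ` of law `μ_lam`, and let
`g n e = 𝔼[exp (lam (S - e)); S ≤ e]` (`orliczLevel`), a normalization of the volume of the Orlicz
ball of level `e`. Since the density of `μ_lam^{⊗n}` depends on `S` only, the law of the first `k`
coordinates of a uniform point of the ball of level `E` has, with respect to `μ_lam^{⊗k}`, the
density `y ↦ g (n - k) (E - ∑ Ψ(yᵢ)) / g n E`, where `g n E` is the mean of the numerator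
(`volume_firstCoords_preimage_inter`). By Markov's inequality `∑ Ψ(yᵢ)` is `O(k) = o(√n)` outside a
set of small measure, so it suffices that `g (n - k)` varies slowly on the scale `√n` in a window of
width `O(√n)` around `n * orliczMean Ψ lam`, and is there comparable to its supremum
(`tvDist_firstCoords_le`).

Both facts follow from two properties of `g n`, without a local limit theorem:

* `g n` is log-concave (`isLogConcave_orliczLevel`), because the volume of the Orlicz ball is
  log-concave in its level. The latter is proved one coordinate at a time from a one-dimensional
  Prékopa–Leindler inequality (`lintegral_add_le_of_min_le`), where all superlevel sets are
  intervals and all functions are maximal at `0`.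
* By the central limit theorem `S` has a probability bounded below to lie in any given window of
  width of order `√n` (`exists_le_measureReal_sum_mem_Ioo`), and `lam * g n` is a probability
  density, that of the sum of `S` and an exponential variable. So `g n` is at least `c / √n`
  somewhere on either side of the window, hence by log-concavity on all of it.

Log-concavity and the bound on the integral then give `g n ≤ C / √n` everywhere
(`IsLogConcave.mul_le_of_lintegral_le`), and the comparison of `g n` at points a distance `√n` apart
bounds the logarithmic slope by `C / √n` (`IsLogConcave.le_rpow_mul`). Therefore a change of the
level by `o(√n)` changes `g n` by a factor `1 + o(1)`.
-/

/-! ### Young functions and their Gibbs measures -/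

theorem IsYoungFunction.continuous {Ψ : ℝ → ℝ} (hΨ : IsYoungFunction Ψ) : Continuous Ψ := by
  have h := hΨ.convexOn.continuousOn isOpen_univ
  exact continuousOn_univ.1 h

/-- A Young function grows at least linearly, with slope `min (Ψ 1) (Ψ (-1))` outside `[-1, 1]`. -/
theorem IsYoungFunction.exists_linear_lower_bound {Ψ : ℝ → ℝ} (hΨ : IsYoungFunction Ψ) :
    ∃ c > 0, ∀ t, c * (|t| - 1) ≤ Ψ t := by
  have h0 : Ψ 0 = 0 := (hΨ.eq_zero_iff 0).2 rfl
  have hpos : ∀ t, t ≠ 0 → 0 < Ψ t := fun t ht =>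
    lt_of_le_of_ne (hΨ.nonneg t) fun h => ht ((hΨ.eq_zero_iff t).1 h.symm)
  refine ⟨min (Ψ 1) (Ψ (-1)), lt_min (hpos 1 (by norm_num)) (hpos (-1) (by norm_num)), fun t => ?_⟩
  have hc0 : 0 ≤ min (Ψ 1) (Ψ (-1)) := le_min (hΨ.nonneg _) (hΨ.nonneg _)
  rcases le_total |t| 1 with ht | ht
  · exact (mul_nonpos_of_nonneg_of_nonpos hc0 (by linarith)).trans (hΨ.nonneg t)
  have htpos : 0 < |t| := by linarith
  -- convexity along the segment from `0` to `t`, which contains `t / |t| = ± 1`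
  have key : Ψ (t / |t|) * |t| ≤ Ψ t := by
    have h := hΨ.convexOn.2 (Set.mem_univ (0 : ℝ)) (Set.mem_univ t)
      (show 0 ≤ 1 - 1 / |t| by rw [sub_nonneg, div_le_one htpos]; exact ht)
      (show 0 ≤ 1 / |t| by positivity) (by ring)
    simp only [smul_eq_mul, mul_zero, zero_add, h0] at h
    rw [one_div_mul_eq_div, one_div_mul_eq_div, le_div_iff₀ htpos] at h
    exact h
  have hmin : min (Ψ 1) (Ψ (-1)) ≤ Ψ (t / |t|) := by
    rcases abs_cases t with ⟨h, h'⟩ | ⟨h, h'⟩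
    · rw [h, div_self (by rintro rfl; simp at htpos)]; exact min_le_left _ _
    · rw [h, div_neg, div_self (by linarith)]; exact min_le_right _ _
  nlinarith [mul_le_mul_of_nonneg_right hmin htpos.le]

theorem IsYoungFunction.integrable_exp {Ψ : ℝ → ℝ} (hΨ : IsYoungFunction Ψ) {a : ℝ} (ha : 0 < a) :
    Integrable (fun t => Real.exp (-a * Ψ t)) := by
  obtain ⟨c, hc, hcΨ⟩ := hΨ.exists_linear_lower_bound
  have hexp : Integrable (fun t : ℝ => Real.exp (a * c) * Real.exp (-(a * c) * |t|)) := by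
    refine Integrable.const_mul ?_ _
    have h1 : IntegrableOn (fun t : ℝ => Real.exp (-(a * c) * |t|)) (Set.Ioi 0) :=
      (integrableOn_exp_mul_Ioi (a := -(a * c)) (by nlinarith) 0).congr_fun
        (fun t (ht : 0 < t) => by simp [abs_of_pos ht]) measurableSet_Ioi
    have h2 : IntegrableOn (fun t : ℝ => Real.exp (-(a * c) * |t|)) (Set.Iic 0) :=
      (integrableOn_exp_mul_Iic (a := a * c) (by positivity) 0).congr_fun
        (fun t (ht : t ≤ 0) => by simp [abs_of_nonpos ht]) measurableSet_Iic
    rw [← integrableOn_univ, ← Set.Iic_union_Ioi (a := (0 : ℝ))]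
    exact h2.union h1
  refine hexp.mono' (by have := hΨ.continuous; fun_prop) (ae_of_all _ fun t => ?_)
  rw [Real.norm_of_nonneg (Real.exp_pos _).le, ← Real.exp_add, Real.exp_le_exp]
  nlinarith [mul_le_mul_of_nonneg_left (hcΨ t) ha.le]

theorem orliczZ_pos {Ψ : ℝ → ℝ} (hΨ : IsYoungFunction Ψ) {lam : ℝ} (hlam : 0 < lam) :
    0 < orliczZ Ψ lam :=
  integral_exp_pos (hΨ.integrable_exp hlam)

theorem isProbabilityMeasure_orliczMeasure {Ψ : ℝ → ℝ} (hΨ : IsYoungFunction Ψ) {lam : ℝ}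
    (hlam : 0 < lam) : IsProbabilityMeasure (orliczMeasure Ψ lam) := by
  have hZ := orliczZ_pos hΨ hlam
  refine ⟨?_⟩
  rw [orliczMeasure, withDensity_apply _ .univ, setLIntegral_univ,
    ← ofReal_integral_eq_lintegral_ofReal ((hΨ.integrable_exp hlam).div_const _)
    (ae_of_all _ fun t => by positivity), integral_div]
  change ENNReal.ofReal (orliczZ Ψ lam / orliczZ Ψ lam) = 1
  rw [div_self hZ.ne', ENNReal.ofReal_one]

theorem memLp_two_orliczMeasure {Ψ : ℝ → ℝ} (hΨ : IsYoungFunction Ψ) {lam : ℝ}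
    (hlam : 0 < lam) : MemLp Ψ 2 (orliczMeasure Ψ lam) := by
  have hc := hΨ.continuous
  have hZ := orliczZ_pos hΨ hlam
  rw [memLp_two_iff_integrable_sq hc.aestronglyMeasurable, orliczMeasure,
    integrable_withDensity_iff (by fun_prop) (ae_of_all _ fun t => ENNReal.ofReal_lt_top)]
  -- `y² exp (-lam y) ≤ (8 / lam²) exp (-(lam / 2) y)`
  refine (((hΨ.integrable_exp (half_pos hlam)).const_mul (8 / lam ^ 2)).div_const
    (orliczZ Ψ lam)).mono' (by
      have := hc.measurable
      exact Measurable.aestronglyMeasurable (by fun_prop)) (ae_of_all _ fun t => ?_)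
  have hy := hΨ.nonneg t
  rw [ENNReal.toReal_ofReal (by positivity), Real.norm_of_nonneg (by positivity), ← mul_div_assoc]
  refine div_le_div_of_nonneg_right ?_ hZ.le
  have h1 := Real.quadratic_le_exp_of_nonneg (x := lam / 2 * Ψ t) (by positivity)
  have h2 : Real.exp (-lam * Ψ t) = Real.exp (-(lam / 2) * Ψ t) * Real.exp (-(lam / 2) * Ψ t) := by
    rw [← Real.exp_add]; ring_nf
  have h3 : Ψ t ^ 2 ≤ 8 / lam ^ 2 * Real.exp (lam / 2 * Ψ t) := by
    rw [div_mul_eq_mul_div, le_div_iff₀ (by positivity)]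
    nlinarith [mul_nonneg hlam.le hy]
  have h4 : Real.exp (lam / 2 * Ψ t) * Real.exp (-(lam / 2) * Ψ t) = 1 := by
    rw [← Real.exp_add, show lam / 2 * Ψ t + -(lam / 2) * Ψ t = 0 by ring, Real.exp_zero]
  rw [h2]
  calc Ψ t ^ 2 * (Real.exp (-(lam / 2) * Ψ t) * Real.exp (-(lam / 2) * Ψ t))
      ≤ 8 / lam ^ 2 * Real.exp (lam / 2 * Ψ t)
        * (Real.exp (-(lam / 2) * Ψ t) * Real.exp (-(lam / 2) * Ψ t)) := by gcongr
    _ = 8 / lam ^ 2 * (Real.exp (lam / 2 * Ψ t) * Real.exp (-(lam / 2) * Ψ t))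
        * Real.exp (-(lam / 2) * Ψ t) := by ring
    _ = _ := by rw [h4, mul_one]

theorem volume_absolutelyContinuous_orliczMeasure {Ψ : ℝ → ℝ} (hΨ : IsYoungFunction Ψ) {lam : ℝ}
    (hlam : 0 < lam) : volume ≪ orliczMeasure Ψ lam := by
  have hc := hΨ.continuous
  have hZ := orliczZ_pos hΨ hlam
  refine withDensity_absolutelyContinuous' (by fun_prop) (ae_of_all _ fun t => ?_)
  exact (ENNReal.ofReal_pos.2 (by positivity)).ne'

/-- `Ψ(X)` is not almost surely constant, because `Ψ` is continuous and not constant and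
`orliczMeasure` charges every open set. -/
theorem variance_orliczMeasure_pos {Ψ : ℝ → ℝ} (hΨ : IsYoungFunction Ψ) {lam : ℝ}
    (hlam : 0 < lam) : 0 < variance Ψ (orliczMeasure Ψ lam) := by
  have := isProbabilityMeasure_orliczMeasure hΨ hlam
  refine lt_of_le_of_ne (variance_nonneg _ _) fun h => ?_
  have h1 := ae_eq_integral_of_variance_eq_zero (memLp_two_orliczMeasure hΨ hlam) h.symm
  have h2 := (volume_absolutelyContinuous_orliczMeasure hΨ hlam).ae_le h1
  have h3 := (hΨ.continuous.ae_eq_iff_eq volume continuous_const).1 h2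
  have h4 : Ψ 1 = Ψ 0 := (congrFun h3 1).trans (congrFun h3 0).symm
  rw [(hΨ.eq_zero_iff 0).2 rfl, hΨ.eq_zero_iff] at h4
  exact one_ne_zero h4

/-! ### Densities of finite product measures -/

theorem lintegral_pi_fin_prod {n : ℕ} {X : Type*} [MeasurableSpace X] (ν : Measure X)
    [SigmaFinite ν] {f : Fin n → X → ENNReal} (hf : ∀ i, Measurable (f i)) :
    ∫⁻ x, ∏ i, f i (x i) ∂(Measure.pi fun _ => ν) = ∏ i, ∫⁻ t, f i t ∂ν := by
  induction n with
  | zero => simp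
  | succ n ih =>
    rw [← (measurePreserving_piFinSuccAbove (fun _ => ν) 0).symm.lintegral_comp
      (f := fun x : Fin (n + 1) → X => ∏ i, f i (x i))
      (Finset.measurable_prod _ fun i _ => (hf i).comp (measurable_pi_apply i))]
    simp_rw [MeasurableEquiv.piFinSuccAbove_symm_apply, Fin.insertNthEquiv,
      Fin.prod_univ_succ, Fin.insertNth_zero, Equiv.coe_fn_mk, Fin.cons_succ, Fin.cons_zero]
    rw [← ih fun i => hf (Fin.succ i)]
    exact lintegral_prod_mul (hf 0).aemeasurable (Finset.measurable_prod _ fun i _ =>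
      (hf (Fin.succ i)).comp (measurable_pi_apply i)).aemeasurable

theorem pi_withDensity_fin {n : ℕ} {X : Type*} [MeasurableSpace X] (ν : Measure X)
    [SigmaFinite ν] {ρ : X → ENNReal} (hρ : Measurable ρ) [SigmaFinite (ν.withDensity ρ)] :
    (Measure.pi fun _ : Fin n => ν.withDensity ρ) =
      (Measure.pi fun _ : Fin n => ν).withDensity fun x => ∏ i, ρ (x i) := by
  refine Measure.pi_eq fun s hs => ?_
  rw [withDensity_apply _ (MeasurableSet.univ_pi hs),
    ← lintegral_indicator (MeasurableSet.univ_pi hs)]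
  have : ∀ x : Fin n → X, (Set.univ.pi s).indicator (fun x => ∏ i, ρ (x i)) x
      = ∏ i, (s i).indicator ρ (x i) := fun x => by
    by_cases hx : x ∈ Set.univ.pi s
    · rw [Set.indicator_of_mem hx]
      exact Finset.prod_congr rfl fun i _ => (Set.indicator_of_mem (hx i (Set.mem_univ i)) _).symm
    · rw [Set.indicator_of_notMem hx]
      simp only [Set.mem_pi, Set.mem_univ, true_imp_iff, not_forall] at hx
      obtain ⟨i, hi⟩ := hx
      exact (Finset.prod_eq_zero (Finset.mem_univ i) (Set.indicator_of_notMem hi _)).symm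
  simp_rw [this]
  rw [lintegral_pi_fin_prod ν fun i => hρ.indicator (hs i)]
  exact Finset.prod_congr rfl fun i _ => by
    rw [withDensity_apply _ (hs i), lintegral_indicator (hs i)]

/-! ### A one-dimensional Prékopa–Leindler inequality -/

/-- The one-dimensional Brunn–Minkowski inequality for bounded intervals. -/
theorem volume_add_le_of_convex {A B C : Set ℝ} {a b : ℝ} (ha : 0 < a) (hb : 0 < b)
    (hab : a + b = 1) (hA : Convex ℝ A) (hB : Convex ℝ B) (hA0 : A.Nonempty) (hB0 : B.Nonempty)
    (hAb : Bornology.IsBounded A) (hBb : Bornology.IsBounded B)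
    (hC : ∀ x ∈ A, ∀ y ∈ B, a * x + b * y ∈ C) :
    ENNReal.ofReal a * volume A + ENNReal.ofReal b * volume B ≤ volume C := by
  have hA1 : sInf A ≤ sSup A := Real.sInf_le_sSup A hAb.bddBelow hAb.bddAbove
  have hB1 : sInf B ≤ sSup B := Real.sInf_le_sSup B hBb.bddBelow hBb.bddAbove
  have hsub : Set.Ioo (a * sInf A + b * sInf B) (a * sSup A + b * sSup B) ⊆ C := by
    rintro z ⟨hz1, hz2⟩
    obtain ⟨x₀, hx₀, hx₀'⟩ := exists_lt_of_csInf_lt hA0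
      (show sInf A < sInf A + (z - (a * sInf A + b * sInf B)) by linarith)
    obtain ⟨y₀, hy₀, hy₀'⟩ := exists_lt_of_csInf_lt hB0
      (show sInf B < sInf B + (z - (a * sInf A + b * sInf B)) by linarith)
    obtain ⟨x₁, hx₁, hx₁'⟩ := exists_lt_of_lt_csSup hA0
      (show sSup A - (a * sSup A + b * sSup B - z) < sSup A by linarith)
    obtain ⟨y₁, hy₁, hy₁'⟩ := exists_lt_of_lt_csSup hB0
      (show sSup B - (a * sSup A + b * sSup B - z) < sSup B by linarith)
    have hb' : b = 1 - a := by linarith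
    subst hb'
    have hlo : a * x₀ + (1 - a) * y₀ < z := by
      nlinarith [mul_lt_mul_of_pos_left hx₀' ha, mul_lt_mul_of_pos_left hy₀' hb]
    have hhi : z < a * x₁ + (1 - a) * y₁ := by
      nlinarith [mul_lt_mul_of_pos_left hx₁' ha, mul_lt_mul_of_pos_left hy₁' hb]
    -- `a * A + b * B` contains a point below and a point above `z`:
    -- interpolate between `(x₀, y₀)` and `(x₁, y₁)`
    set lo := a * x₀ + (1 - a) * y₀ with hlo_def
    set hi := a * x₁ + (1 - a) * y₁ with hhi_def
    set t := (z - lo) / (hi - lo) with ht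
    have hd : 0 < hi - lo := by linarith
    have ht0 : 0 ≤ t := div_nonneg (by linarith) hd.le
    have ht1 : t ≤ 1 := (div_le_one hd).2 (by linarith)
    have htz : t * (hi - lo) = z - lo := div_mul_cancel₀ _ hd.ne'
    have hx := hA hx₀ hx₁ (sub_nonneg.2 ht1) ht0 (by ring)
    have hy := hB hy₀ hy₁ (sub_nonneg.2 ht1) ht0 (by ring)
    have := hC _ hx _ hy
    simp only [smul_eq_mul] at this
    convert this using 1
    rw [hhi_def, hlo_def] at htz
    linarith
  have hAv : volume A ≤ ENNReal.ofReal (sSup A - sInf A) := by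
    rw [← Real.volume_Icc]
    exact measure_mono fun x hx => ⟨csInf_le hAb.bddBelow hx, le_csSup hAb.bddAbove hx⟩
  have hBv : volume B ≤ ENNReal.ofReal (sSup B - sInf B) := by
    rw [← Real.volume_Icc]
    exact measure_mono fun x hx => ⟨csInf_le hBb.bddBelow hx, le_csSup hBb.bddAbove hx⟩
  calc ENNReal.ofReal a * volume A + ENNReal.ofReal b * volume B
      ≤ ENNReal.ofReal a * ENNReal.ofReal (sSup A - sInf A)
        + ENNReal.ofReal b * ENNReal.ofReal (sSup B - sInf B) := by gcongr
    _ = ENNReal.ofReal ((a * sSup A + b * sSup B) - (a * sInf A + b * sInf B)) := by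
        rw [← ENNReal.ofReal_mul ha.le, ← ENNReal.ofReal_mul hb.le, ← ENNReal.ofReal_add
          (mul_nonneg ha.le (by linarith)) (mul_nonneg hb.le (by linarith))]
        ring_nf
    _ ≤ volume C := by rw [← Real.volume_Ioo]; exact measure_mono hsub

/-- A one-dimensional Prékopa–Leindler inequality for functions with the same maximum and with
superlevel sets that are intervals, obtained by integrating the Brunn–Minkowski inequality over
the levels. -/
theorem lintegral_add_le_of_min_le {f g h : ℝ → ℝ} {a b R : ℝ} (ha : 0 < a) (hb : 0 < b)
    (hab : a + b = 1) (hf : Measurable f) (hg : Measurable g) (hh : Measurable h)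
    (hf0 : ∀ x, 0 ≤ f x) (hg0 : ∀ x, 0 ≤ g x) (hh0 : ∀ x, 0 ≤ h x)
    (hf1 : ∀ x, f x ≤ f 0) (hg1 : ∀ x, g x ≤ g 0) (hfg : f 0 = g 0)
    (hfc : ∀ r, Convex ℝ {x | r < f x}) (hgc : ∀ r, Convex ℝ {x | r < g x})
    (hfR : ∀ x, 0 < f x → |x| ≤ R) (hgR : ∀ x, 0 < g x → |x| ≤ R)
    (hmin : ∀ x y, min (f x) (g y) ≤ h (a * x + b * y)) :
    ENNReal.ofReal a * (∫⁻ x, ENNReal.ofReal (f x))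
        + ENNReal.ofReal b * (∫⁻ x, ENNReal.ofReal (g x))
      ≤ ∫⁻ x, ENNReal.ofReal (h x) := by
  have hbdd : ∀ {f : ℝ → ℝ}, (∀ x, 0 < f x → |x| ≤ R) → ∀ {t : ℝ}, 0 < t →
      Bornology.IsBounded {x | t < f x} := fun hfR t ht =>
    (Metric.isBounded_closedBall (x := (0 : ℝ)) (r := R)).subset fun x hx => by
      simpa using hfR x (ht.trans hx)
  have hanti : Antitone fun t : ℝ => volume {x | t < f x} := fun s t hst =>
    measure_mono fun x hx => lt_of_le_of_lt hst hx
  rw [lintegral_eq_lintegral_meas_lt volume (ae_of_all _ hf0) hf.aemeasurable,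
    lintegral_eq_lintegral_meas_lt volume (ae_of_all _ hg0) hg.aemeasurable,
    lintegral_eq_lintegral_meas_lt volume (ae_of_all _ hh0) hh.aemeasurable,
    ← lintegral_const_mul' _ _ ENNReal.ofReal_ne_top,
    ← lintegral_const_mul' _ _ ENNReal.ofReal_ne_top,
    ← lintegral_add_left (hanti.measurable.const_mul _)]
  refine setLIntegral_mono' measurableSet_Ioi fun t (ht : 0 < t) => ?_
  rcases lt_or_ge t (f 0) with ht1 | ht1
  · exact volume_add_le_of_convex ha hb hab (hfc t) (hgc t) ⟨0, ht1⟩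
      ⟨0, show t < g 0 from hfg ▸ ht1⟩
      (hbdd hfR ht) (hbdd hgR ht) fun x hx y hy => (lt_min hx hy).trans_le (hmin x y)
  · have h1 : {x | t < f x} = ∅ :=
      Set.eq_empty_of_forall_notMem fun x hx => absurd ((hf1 x).trans ht1) (not_le.2 hx)
    have h2 : {x | t < g x} = ∅ :=
      Set.eq_empty_of_forall_notMem fun x hx =>
        absurd ((hg1 x).trans (hfg ▸ ht1)) (not_le.2 hx)
    simp [h1, h2]

/-! ### Log-concavity of the volume of Orlicz balls -/

/-- The volume of the Orlicz ball, as a real number. -/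
noncomputable def orliczVolume (Ψ : ℝ → ℝ) (n : ℕ) (e : ℝ) : ℝ :=
  volume.real (orliczBall Ψ e n)

theorem orliczVolume_nonneg (Ψ : ℝ → ℝ) (n : ℕ) (e : ℝ) : 0 ≤ orliczVolume Ψ n e :=
  measureReal_nonneg

namespace IsYoungFunction

variable {Ψ : ℝ → ℝ}

theorem map_zero (hΨ : IsYoungFunction Ψ) : Ψ 0 = 0 := (hΨ.eq_zero_iff 0).2 rfl

theorem measurable_sum (hΨ : IsYoungFunction Ψ) (n : ℕ) :
    Measurable fun x : Fin n → ℝ => ∑ i, Ψ (x i) := by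
  have := hΨ.continuous
  exact Continuous.measurable (by fun_prop)

theorem measurableSet_orliczBall (hΨ : IsYoungFunction Ψ) (e : ℝ) (n : ℕ) :
    MeasurableSet (orliczBall Ψ e n) :=
  measurableSet_le (hΨ.measurable_sum n) measurable_const

theorem abs_le_of_le (hΨ : IsYoungFunction Ψ) : ∃ c > 0, ∀ t e, Ψ t ≤ e → |t| ≤ e / c + 1 := by
  obtain ⟨c, hc, h⟩ := hΨ.exists_linear_lower_bound
  refine ⟨c, hc, fun t e hte => ?_⟩
  rw [← sub_le_iff_le_add, le_div_iff₀ hc, mul_comm]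
  exact (h t).trans hte

theorem volume_orliczBall_lt_top (hΨ : IsYoungFunction Ψ) (e : ℝ) (n : ℕ) :
    volume (orliczBall Ψ e n) < ⊤ := by
  obtain ⟨c, -, h⟩ := hΨ.abs_le_of_le
  refine lt_of_le_of_lt (measure_mono fun x (hx : ∑ i, Ψ (x i) ≤ e) => ?_)
    (isCompact_univ_pi fun _ : Fin n =>
      isCompact_Icc (a := -(e / c + 1)) (b := e / c + 1)).measure_lt_top
  refine fun i _ => abs_le.1 (h _ _ ?_)
  exact (Finset.single_le_sum (f := fun i => Ψ (x i)) (fun j _ => hΨ.nonneg _)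
    (Finset.mem_univ i)).trans hx

theorem ofReal_orliczVolume (hΨ : IsYoungFunction Ψ) (n : ℕ) (e : ℝ) :
    ENNReal.ofReal (orliczVolume Ψ n e) = volume (orliczBall Ψ e n) :=
  ENNReal.ofReal_toReal (hΨ.volume_orliczBall_lt_top e n).ne

theorem orliczVolume_mono (hΨ : IsYoungFunction Ψ) (n : ℕ) : Monotone (orliczVolume Ψ n) :=
  fun _ e' h => measureReal_mono (fun _ hx => le_trans hx h)
    (hΨ.volume_orliczBall_lt_top e' n).ne

theorem orliczVolume_pos (hΨ : IsYoungFunction Ψ) (n : ℕ) {e : ℝ} (he : 0 < e) :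
    0 < orliczVolume Ψ n e := by
  refine ENNReal.toReal_pos ?_ (hΨ.volume_orliczBall_lt_top e n).ne
  have hc := hΨ.continuous
  have ho : IsOpen {x : Fin n → ℝ | ∑ i, Ψ (x i) < e} :=
    isOpen_lt (by fun_prop) continuous_const
  exact ((ho.measure_pos volume ⟨0, by simpa [hΨ.map_zero] using he⟩).trans_le
    (measure_mono fun x (hx : _ < e) => hx.le)).ne'

theorem orliczVolume_of_neg (hΨ : IsYoungFunction Ψ) (n : ℕ) {e : ℝ} (he : e < 0) :
    orliczVolume Ψ n e = 0 := by
  have : orliczBall Ψ e n = ∅ := Set.eq_empty_of_forall_notMem fun x hx =>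
    absurd (lt_of_le_of_lt hx he) (not_lt.2 (Finset.sum_nonneg fun i _ => hΨ.nonneg _))
  simp [orliczVolume, this]

theorem orliczVolume_succ (hΨ : IsYoungFunction Ψ) (n : ℕ) (e : ℝ) :
    ENNReal.ofReal (orliczVolume Ψ (n + 1) e)
      = ∫⁻ t, ENNReal.ofReal (orliczVolume Ψ n (e - Ψ t)) := by
  have hmp := (volume_preserving_piFinSuccAbove (fun _ : Fin (n + 1) => ℝ) 0).symm
  rw [hΨ.ofReal_orliczVolume,
    ← hmp.measure_preimage (hΨ.measurableSet_orliczBall _ _).nullMeasurableSet]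
  rw [Measure.volume_eq_prod,
    Measure.prod_apply (hmp.measurable (hΨ.measurableSet_orliczBall _ _))]
  refine lintegral_congr fun t => ?_
  rw [hΨ.ofReal_orliczVolume]
  congr 1
  ext x
  simp [orliczBall, Fin.sum_univ_succ, MeasurableEquiv.piFinSuccAbove_symm_apply,
    Fin.insertNthEquiv, le_sub_iff_add_le']

/-- The volume of the Orlicz ball is a log-concave function of its level: this is the
Prékopa–Leindler inequality, applied coordinate by coordinate. -/
theorem orliczVolume_rpow_mul_rpow_le (hΨ : IsYoungFunction Ψ) (n : ℕ) {a b : ℝ} (ha : 0 < a)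
    (hb : 0 < b) (hab : a + b = 1) (e₁ e₂ : ℝ) :
    orliczVolume Ψ n e₁ ^ a * orliczVolume Ψ n e₂ ^ b ≤ orliczVolume Ψ n (a * e₁ + b * e₂) := by
  induction n generalizing e₁ e₂ with
  | zero =>
    have h1 : ∀ e, 0 ≤ e → orliczVolume Ψ 0 e = 1 := fun e he => by
      have : orliczBall Ψ e 0 = Set.univ := by ext x; simp [orliczBall, he]
      rw [orliczVolume, this, measureReal_def, volume_pi, Measure.pi_empty_univ,
        ENNReal.toReal_one]
    rcases lt_or_ge e₁ 0 with h | h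
    · rw [hΨ.orliczVolume_of_neg 0 h, Real.zero_rpow ha.ne', zero_mul]
      exact orliczVolume_nonneg _ _ _
    rcases lt_or_ge e₂ 0 with h' | h'
    · rw [hΨ.orliczVolume_of_neg 0 h', Real.zero_rpow hb.ne', mul_zero]
      exact orliczVolume_nonneg _ _ _
    rw [h1 _ h, h1 _ h', h1 _ (by positivity)]
    simp
  | succ n ih =>
    have hle : ∀ e t, orliczVolume Ψ n (e - Ψ t) ≤ orliczVolume Ψ n e := fun e t =>
      hΨ.orliczVolume_mono n (by linarith [hΨ.nonneg t])
    have hzero : ∀ e, orliczVolume Ψ n e = 0 → orliczVolume Ψ (n + 1) e = 0 := fun e he => by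
      have h : ENNReal.ofReal (orliczVolume Ψ (n + 1) e) = 0 := by
        rw [hΨ.orliczVolume_succ]
        refine (lintegral_congr fun t => ?_).trans lintegral_zero
        rw [ENNReal.ofReal_eq_zero, ← he]
        exact hle e t
      exact le_antisymm (ENNReal.ofReal_eq_zero.1 h) (orliczVolume_nonneg _ _ _)
    rcases (orliczVolume_nonneg Ψ n e₁).eq_or_lt with h₁ | h₁
    · rw [hzero _ h₁.symm, Real.zero_rpow ha.ne', zero_mul]
      exact orliczVolume_nonneg _ _ _
    rcases (orliczVolume_nonneg Ψ n e₂).eq_or_lt with h₂ | h₂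
    · rw [hzero _ h₂.symm, Real.zero_rpow hb.ne', mul_zero]
      exact orliczVolume_nonneg _ _ _
    have hm : ∀ e, Measurable fun t => orliczVolume Ψ n (e - Ψ t) := fun e =>
      (hΨ.orliczVolume_mono n).measurable.comp (measurable_const.sub hΨ.continuous.measurable)
    have hconv : ∀ e v, 0 < v → ∀ r, Convex ℝ {t | r < orliczVolume Ψ n (e - Ψ t) / v} := by
      intro e v hv r
      have h : Antitone fun y => orliczVolume Ψ n (e - y) / v := fun y z hyz =>
        div_le_div_of_nonneg_right (hΨ.orliczVolume_mono n (by linarith)) hv.le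
      simpa using (hΨ.convexOn.quasiconvexOn.antitone_comp h).convex_gt r
    have hbd : ∃ R, ∀ e ∈ ({e₁, e₂} : Set ℝ), ∀ t, 0 < orliczVolume Ψ n (e - Ψ t) → |t| ≤ R := by
      obtain ⟨c, hc, h⟩ := hΨ.abs_le_of_le
      refine ⟨max e₁ e₂ / c + 1, fun e he t ht => h _ _ ?_⟩
      have h1 : Ψ t ≤ e := by
        by_contra hcon
        rw [hΨ.orliczVolume_of_neg n (by linarith)] at ht
        exact lt_irrefl _ ht
      rcases he with rfl | rfl
      · exact h1.trans (le_max_left _ _)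
      · exact h1.trans (le_max_right _ _)
    obtain ⟨R, hR⟩ := hbd
    -- normalize the three functions so that the maxima of `f` and `g`, attained at `0`, are `1`
    set v₁ := orliczVolume Ψ n e₁
    set v₂ := orliczVolume Ψ n e₂
    set w := v₁ ^ a * v₂ ^ b
    have hw : 0 < w := by positivity
    set e := a * e₁ + b * e₂
    have key := lintegral_add_le_of_min_le (f := fun t => orliczVolume Ψ n (e₁ - Ψ t) / v₁)
      (g := fun t => orliczVolume Ψ n (e₂ - Ψ t) / v₂)
      (h := fun t => orliczVolume Ψ n (e - Ψ t) / w) (R := R) ha hb hab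
      ((hm _).div_const _) ((hm _).div_const _) ((hm _).div_const _)
      (fun _ => div_nonneg (orliczVolume_nonneg _ _ _) h₁.le)
      (fun _ => div_nonneg (orliczVolume_nonneg _ _ _) h₂.le)
      (fun _ => div_nonneg (orliczVolume_nonneg _ _ _) hw.le)
      (fun x => by simpa [hΨ.map_zero] using div_le_div_of_nonneg_right (hle _ _) h₁.le)
      (fun x => by simpa [hΨ.map_zero] using div_le_div_of_nonneg_right (hle _ _) h₂.le)
      (by simp [hΨ.map_zero, v₁, v₂, h₁.ne', h₂.ne'])
      (hconv e₁ v₁ h₁) (hconv e₂ v₂ h₂)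
      (fun x hx => hR e₁ (by simp) x ((div_pos_iff_of_pos_right h₁).1 hx))
      (fun x hx => hR e₂ (by simp) x ((div_pos_iff_of_pos_right h₂).1 hx))
      (fun x y => by
        have hx := div_nonneg (orliczVolume_nonneg Ψ n (e₁ - Ψ x)) h₁.le
        have hy := div_nonneg (orliczVolume_nonneg Ψ n (e₂ - Ψ y)) h₂.le
        set p := orliczVolume Ψ n (e₁ - Ψ x) / v₁ with hp
        set q := orliczVolume Ψ n (e₂ - Ψ y) / v₂ with hq
        have hmn : 0 ≤ min p q := le_min hx hy
        calc min p q = min p q ^ a * min p q ^ b := by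
              rw [← Real.rpow_add_of_nonneg hmn ha.le hb.le, hab, Real.rpow_one]
          _ ≤ p ^ a * q ^ b := by
              gcongr
              · exact min_le_left _ _
              · exact min_le_right _ _
          _ = orliczVolume Ψ n (e₁ - Ψ x) ^ a * orliczVolume Ψ n (e₂ - Ψ y) ^ b / w := by
              rw [hp, hq, Real.div_rpow (orliczVolume_nonneg _ _ _) h₁.le,
                Real.div_rpow (orliczVolume_nonneg _ _ _) h₂.le, div_mul_div_comm]
          _ ≤ orliczVolume Ψ n (a * (e₁ - Ψ x) + b * (e₂ - Ψ y)) / w := by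
              gcongr
              exact ih _ _
          _ ≤ _ := by
              gcongr
              refine hΨ.orliczVolume_mono n ?_
              have := hΨ.convexOn.2 (Set.mem_univ x) (Set.mem_univ y) ha.le hb.le hab
              simp only [smul_eq_mul] at this
              simp only [e]
              linarith)
    have hdiv : ∀ e v, 0 < v → ∫⁻ t, ENNReal.ofReal (orliczVolume Ψ n (e - Ψ t) / v)
        = ENNReal.ofReal (orliczVolume Ψ (n + 1) e / v) := fun e v hv => by
      simp_rw [div_eq_inv_mul, ENNReal.ofReal_mul (inv_nonneg.2 hv.le)]
      rw [lintegral_const_mul' _ _ ENNReal.ofReal_ne_top, hΨ.orliczVolume_succ]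
    rw [hdiv _ _ h₁, hdiv _ _ h₂, hdiv _ _ hw] at key
    have n1 := div_nonneg (orliczVolume_nonneg Ψ (n + 1) e₁) h₁.le
    have n2 := div_nonneg (orliczVolume_nonneg Ψ (n + 1) e₂) h₂.le
    rw [← ENNReal.ofReal_mul ha.le, ← ENNReal.ofReal_mul hb.le, ← ENNReal.ofReal_add
      (by positivity) (by positivity), ENNReal.ofReal_le_ofReal_iff
      (div_nonneg (orliczVolume_nonneg _ _ _) hw.le)] at key
    have amgm := (Real.geom_mean_le_arith_mean2_weighted ha.le hb.le n1 n2 hab).trans key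
    rw [Real.div_rpow (orliczVolume_nonneg _ _ _) h₁.le,
      Real.div_rpow (orliczVolume_nonneg _ _ _) h₂.le, div_mul_div_comm] at amgm
    exact (div_le_div_iff_of_pos_right hw).1 amgm

end IsYoungFunction

/-! ### Log-concave functions on the line -/

/-- A nonnegative function on `ℝ` is log-concave if it satisfies
`h x ^ a * h y ^ b ≤ h (a * x + b * y)` for all weights `a, b > 0` with `a + b = 1`; zeros of `h`
are allowed. -/
structure IsLogConcave (h : ℝ → ℝ) : Prop where
  nonneg : ∀ x, 0 ≤ h x
  rpow_mul_rpow_le : ∀ ⦃a b : ℝ⦄, 0 < a → 0 < b → a + b = 1 → ∀ x y,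
    h x ^ a * h y ^ b ≤ h (a * x + b * y)

namespace IsLogConcave

variable {h : ℝ → ℝ}

theorem le_of_mem_Icc (hh : IsLogConcave h) {p q z l : ℝ} (hl : 0 ≤ l) (hp : l ≤ h p)
    (hq : l ≤ h q) (hz : z ∈ Set.Icc p q) : l ≤ h z := by
  rcases hz.1.eq_or_lt with rfl | hz1
  · exact hp
  rcases hz.2.eq_or_lt with rfl | hz2
  · exact hq
  have hd : 0 < q - p := by linarith
  have ha : 0 < (q - z) / (q - p) := div_pos (by linarith) hd
  have hb : 0 < (z - p) / (q - p) := div_pos (by linarith) hd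
  have hab : (q - z) / (q - p) + (z - p) / (q - p) = 1 := by field_simp; ring
  have key := hh.rpow_mul_rpow_le ha hb hab p q
  have hp0 := hh.nonneg p
  calc l = l ^ ((q - z) / (q - p)) * l ^ ((z - p) / (q - p)) := by
        rw [← Real.rpow_add_of_nonneg hl ha.le hb.le, hab, Real.rpow_one]
    _ ≤ h p ^ ((q - z) / (q - p)) * h q ^ ((z - p) / (q - p)) := by gcongr
    _ ≤ _ := key
    _ = h z := by congr 1; field_simp; ring

/-- A large value `h x`, averaged with values at least `l` on an interval of length `w`, would
produce an interval of length `w / 2` on which `h` is at least `√(h x * l)`; so an integrable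
log-concave function which is not small on an interval is bounded. -/
theorem mul_le_of_lintegral_le (hh : IsLogConcave h) {a w l J : ℝ} (hw : 0 ≤ w)
    (hl : 0 ≤ l) (hJ : 0 ≤ J) (hlow : ∀ y ∈ Set.Icc a (a + w), l ≤ h y)
    (hint : ∫⁻ y, ENNReal.ofReal (h y) ≤ ENNReal.ofReal J) (x : ℝ) :
    h x * l * w ^ 2 ≤ 4 * J ^ 2 := by
  have hx := hh.nonneg x
  have h1 : ∀ z ∈ Set.Icc ((x + a) / 2) ((x + a + w) / 2), √(h x * l) ≤ h z := by
    rintro z ⟨hz1, hz2⟩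
    have key := hh.rpow_mul_rpow_le (a := 1 / 2) (b := 1 / 2) (by norm_num) (by norm_num)
      (by norm_num) x (2 * z - x)
    rw [← Real.sqrt_eq_rpow, ← Real.sqrt_eq_rpow, ← Real.sqrt_mul hx] at key
    calc √(h x * l) ≤ √(h x * h (2 * z - x)) := by
          gcongr
          exact hlow _ ⟨by linarith, by linarith⟩
      _ ≤ _ := key
      _ = h z := by congr 1; ring
  have h2 : ENNReal.ofReal (√(h x * l) * (w / 2)) ≤ ENNReal.ofReal J := by
    refine le_trans ?_ hint
    calc ENNReal.ofReal (√(h x * l) * (w / 2))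
        = ∫⁻ _ in Set.Icc ((x + a) / 2) ((x + a + w) / 2), ENNReal.ofReal √(h x * l) := by
          rw [setLIntegral_const, Real.volume_Icc, ENNReal.ofReal_mul (Real.sqrt_nonneg _)]
          ring_nf
      _ ≤ ∫⁻ y in Set.Icc ((x + a) / 2) ((x + a + w) / 2), ENNReal.ofReal (h y) :=
          setLIntegral_mono' measurableSet_Icc fun z hz => ENNReal.ofReal_le_ofReal (h1 z hz)
      _ ≤ _ := setLIntegral_le_lintegral _ _
  have h3 := (ENNReal.ofReal_le_ofReal_iff hJ).1 h2
  have h4 : (√(h x * l) * (w / 2)) ^ 2 ≤ J ^ 2 := by gcongr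
  rw [mul_pow, Real.sq_sqrt (mul_nonneg hx hl)] at h4
  linarith

/-- A log-concave function varies slowly between `e` and `e'` if it does not increase by more than
a factor `D` between the point at distance `w` from `e` on the side opposite to `e'`, and `e`. -/
theorem le_rpow_mul (hh : IsLogConcave h) {e e' w D : ℝ} (hw : 0 < w) (hD : 1 ≤ D)
    (he : 0 < h e) (hq : ∀ q, |q - e| = w → 0 < h q ∧ h e ≤ D * h q) :
    h e' ≤ D ^ (|e' - e| / w) * h e := by
  rcases eq_or_ne e' e with rfl | hne
  · simp
  have hd : 0 < |e' - e| := abs_pos.2 (sub_ne_zero.2 hne)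
  set d := |e' - e| with hd_def
  set q := e - w / d * (e' - e) with hq_def
  obtain ⟨hq0, hqD⟩ := hq q (by
    rw [hq_def, sub_sub_cancel_left, abs_neg, abs_mul, abs_of_pos (div_pos hw hd), ← hd_def,
      div_mul_cancel₀ _ hd.ne'])
  have hdw : 0 < d + w := by linarith
  have key := hh.rpow_mul_rpow_le (a := d / (d + w)) (b := w / (d + w)) (by positivity)
    (by positivity) (by field_simp) q e'
  have hcomb : d / (d + w) * q + w / (d + w) * e' = e := by
    rw [hq_def]; field_simp; ring
  rw [hcomb] at key
  -- raise to the power `(d + w) / w`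
  have h1 : h q ^ (d / w) * h e' ≤ h e ^ (1 + d / w) := by
    have := Real.rpow_le_rpow (mul_nonneg (Real.rpow_nonneg (hh.nonneg _) _)
      (Real.rpow_nonneg (hh.nonneg _) _)) key (z := 1 + d / w) (by positivity)
    rw [Real.mul_rpow (Real.rpow_nonneg (hh.nonneg _) _) (Real.rpow_nonneg (hh.nonneg _) _),
      ← Real.rpow_mul (hh.nonneg _), ← Real.rpow_mul (hh.nonneg _)] at this
    rwa [show d / (d + w) * (1 + d / w) = d / w by field_simp; ring,
      show w / (d + w) * (1 + d / w) = 1 by field_simp; ring, Real.rpow_one] at this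
  have h2 : h e ^ (d / w) ≤ D ^ (d / w) * h q ^ (d / w) := by
    rw [← Real.mul_rpow (by linarith) hq0.le]
    exact Real.rpow_le_rpow he.le hqD (by positivity)
  rw [Real.rpow_add he, Real.rpow_one] at h1
  have h3 : 0 < h q ^ (d / w) := Real.rpow_pos_of_pos hq0 _
  refine le_of_mul_le_mul_left (h1.trans ?_) h3
  nlinarith [mul_le_mul_of_nonneg_left h2 he.le]

end IsLogConcave

/-! ### The normalized volume as an expectation -/

/-- `orliczLevel Ψ lam n e = 𝔼[exp (lam (S - e)); S ≤ e]` where `S = Ψ(X₁) + ⋯ + Ψ(Xₙ)` for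
independent `Xᵢ` of law `μ_lam`: the volume of the Orlicz ball of level `e`, suitably normalized.
Up to the factor `lam`, this is the density at `e` of the sum of `S` and an independent exponential
variable of rate `lam`. -/
noncomputable def orliczLevel (Ψ : ℝ → ℝ) (lam : ℝ) (n : ℕ) (e : ℝ) : ℝ :=
  orliczVolume Ψ n e * (Real.exp (-lam * e) / orliczZ Ψ lam ^ n)

section

variable {Ψ : ℝ → ℝ} {lam : ℝ}

theorem orliczLevel_nonneg (hΨ : IsYoungFunction Ψ) (hlam : 0 < lam) (n : ℕ) (e : ℝ) :
    0 ≤ orliczLevel Ψ lam n e :=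
  mul_nonneg (orliczVolume_nonneg _ _ _)
    (div_nonneg (Real.exp_pos _).le (pow_nonneg (orliczZ_pos hΨ hlam).le n))

theorem isLogConcave_orliczLevel (hΨ : IsYoungFunction Ψ) (hlam : 0 < lam) (n : ℕ) :
    IsLogConcave (orliczLevel Ψ lam n) where
  nonneg := orliczLevel_nonneg hΨ hlam n
  rpow_mul_rpow_le a b ha hb hab x y := by
    have hZ : 0 < orliczZ Ψ lam ^ n := pow_pos (orliczZ_pos hΨ hlam) n
    have hE : ∀ e, 0 < Real.exp (-lam * e) / orliczZ Ψ lam ^ n := fun e => by positivity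
    unfold orliczLevel
    rw [Real.mul_rpow (orliczVolume_nonneg _ _ _) (hE _).le,
      Real.mul_rpow (orliczVolume_nonneg _ _ _) (hE _).le, mul_mul_mul_comm]
    refine mul_le_mul (hΨ.orliczVolume_rpow_mul_rpow_le n ha hb hab x y) (le_of_eq ?_)
      (by positivity) (orliczVolume_nonneg _ _ _)
    rw [Real.div_rpow (Real.exp_pos _).le hZ.le, Real.div_rpow (Real.exp_pos _).le hZ.le,
      div_mul_div_comm, ← Real.rpow_add hZ, hab, Real.rpow_one, ← Real.exp_mul, ← Real.exp_mul,
      ← Real.exp_add]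
    ring_nf

/-- The kernel `u ↦ exp (lam u)` on `u ≤ 0`. -/
noncomputable def expKernel (lam : ℝ) : ℝ → ENNReal :=
  (Set.Iic 0).indicator fun u => ENNReal.ofReal (Real.exp (lam * u))

theorem measurable_expKernel (lam : ℝ) : Measurable (expKernel lam) :=
  Measurable.indicator (by fun_prop) measurableSet_Iic

theorem pi_orliczMeasure_eq_withDensity (hΨ : IsYoungFunction Ψ) (hlam : 0 < lam) (n : ℕ) :
    (Measure.pi fun _ : Fin n => orliczMeasure Ψ lam) = volume.withDensity fun x : Fin n → ℝ =>
      ENNReal.ofReal (Real.exp (-lam * ∑ i, Ψ (x i)) / orliczZ Ψ lam ^ n) := by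
  have hZ := orliczZ_pos hΨ hlam
  have := isProbabilityMeasure_orliczMeasure hΨ hlam
  have hc := hΨ.continuous
  rw [orliczMeasure] at this ⊢
  rw [pi_withDensity_fin volume (by fun_prop), volume_pi]
  congr 1
  ext x : 1
  rw [← ENNReal.ofReal_prod_of_nonneg fun i _ => by positivity]
  congr 1
  rw [Finset.prod_div_distrib, Finset.prod_const, Finset.card_univ, Fintype.card_fin,
    ← Real.exp_sum, Finset.mul_sum]

/-- Volumes inside the Orlicz ball, in terms of the product measure: on the ball the density
`exp (-lam S)` only depends on `S`. -/
theorem volume_inter_orliczBall (hΨ : IsYoungFunction Ψ) (hlam : 0 < lam) (n : ℕ) (e : ℝ)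
    {A : Set (Fin n → ℝ)} (hA : MeasurableSet A) :
    volume (A ∩ orliczBall Ψ e n) * ENNReal.ofReal (Real.exp (-lam * e) / orliczZ Ψ lam ^ n) =
      ∫⁻ x in A, expKernel lam (∑ i, Ψ (x i) - e)
        ∂(Measure.pi fun _ : Fin n => orliczMeasure Ψ lam) := by
  have hZ : 0 < orliczZ Ψ lam ^ n := pow_pos (orliczZ_pos hΨ hlam) n
  have hm := hΨ.measurable_sum n
  have hk : Measurable fun x : Fin n → ℝ => expKernel lam (∑ i, Ψ (x i) - e) :=
    (measurable_expKernel lam).comp (hm.sub_const e)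
  rw [pi_orliczMeasure_eq_withDensity hΨ hlam,
    setLIntegral_withDensity_eq_setLIntegral_mul _ (by fun_prop) hk hA]
  have h : ∀ x : Fin n → ℝ, ((fun x : Fin n → ℝ =>
      ENNReal.ofReal (Real.exp (-lam * ∑ i, Ψ (x i)) / orliczZ Ψ lam ^ n)) *
        fun x : Fin n → ℝ => expKernel lam (∑ i, Ψ (x i) - e)) x =
      (orliczBall Ψ e n).indicator
        (fun _ => ENNReal.ofReal (Real.exp (-lam * e) / orliczZ Ψ lam ^ n)) x := fun x => by
    rw [Pi.mul_apply, expKernel]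
    by_cases hx : ∑ i, Ψ (x i) ≤ e
    · rw [Set.indicator_of_mem (show x ∈ orliczBall Ψ e n from hx),
        Set.indicator_of_mem (by simpa using hx), ← ENNReal.ofReal_mul (by positivity),
        div_mul_eq_mul_div, ← Real.exp_add]
      ring_nf
    · rw [Set.indicator_of_notMem (show x ∉ orliczBall Ψ e n from hx),
        Set.indicator_of_notMem (by simpa using hx), mul_zero]
  rw [lintegral_congr h]
  rw [lintegral_indicator_const (hΨ.measurableSet_orliczBall e n),
    Measure.restrict_apply (hΨ.measurableSet_orliczBall e n), Set.inter_comm, mul_comm]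

theorem ofReal_orliczLevel (hΨ : IsYoungFunction Ψ) (hlam : 0 < lam) (n : ℕ) (e : ℝ) :
    ENNReal.ofReal (orliczLevel Ψ lam n e) = ∫⁻ x, expKernel lam (∑ i, Ψ (x i) - e)
        ∂(Measure.pi fun _ : Fin n => orliczMeasure Ψ lam) := by
  rw [← setLIntegral_univ, ← volume_inter_orliczBall hΨ hlam n e .univ, Set.univ_inter,
    orliczLevel, ENNReal.ofReal_mul (orliczVolume_nonneg _ _ _), hΨ.ofReal_orliczVolume]

theorem lintegral_expKernel (hlam : 0 < lam) (s : ℝ) :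
    ∫⁻ e, expKernel lam (s - e) = ENNReal.ofReal (1 / lam) := by
  rw [lintegral_sub_left_eq_self (expKernel lam) s]
  unfold expKernel
  rw [lintegral_indicator measurableSet_Iic,
    ← ofReal_integral_eq_lintegral_ofReal (integrableOn_exp_mul_Iic hlam 0)
      (ae_of_all _ fun t => (Real.exp_pos _).le), integral_exp_mul_Iic hlam]
  simp

theorem setLIntegral_orliczLevel (hΨ : IsYoungFunction Ψ) (hlam : 0 < lam) (n : ℕ) (A : Set ℝ) :
    ∫⁻ e in A, ENNReal.ofReal (orliczLevel Ψ lam n e) =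
      ∫⁻ x, (∫⁻ e in A, expKernel lam (∑ i, Ψ (x i) - e))
        ∂(Measure.pi fun _ : Fin n => orliczMeasure Ψ lam) := by
  have := isProbabilityMeasure_orliczMeasure hΨ hlam
  simp_rw [ofReal_orliczLevel hΨ hlam]
  refine lintegral_lintegral_swap (Measurable.aemeasurable ?_)
  exact (measurable_expKernel lam).comp
    (((hΨ.measurable_sum n).comp measurable_snd).sub measurable_fst)

theorem lintegral_orliczLevel (hΨ : IsYoungFunction Ψ) (hlam : 0 < lam) (n : ℕ) :
    ∫⁻ e, ENNReal.ofReal (orliczLevel Ψ lam n e) = ENNReal.ofReal (1 / lam) := by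
  have := isProbabilityMeasure_orliczMeasure hΨ hlam
  rw [← setLIntegral_univ, setLIntegral_orliczLevel hΨ hlam]
  simp_rw [setLIntegral_univ, lintegral_expKernel hlam]
  simp

/-- If `S` is likely to lie in `(u, v]`, then `orliczLevel` is not small somewhere in
`(u, v + 1]`. -/
theorem exists_le_orliczLevel (hΨ : IsYoungFunction Ψ) (hlam : 0 < lam) (n : ℕ) {u v c : ℝ}
    (huv : u ≤ v) (hc : c ≤ (Measure.pi fun _ : Fin n => orliczMeasure Ψ lam).real
      {x : Fin n → ℝ | ∑ i, Ψ (x i) ∈ Set.Ioc u v}) :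
    ∃ e ∈ Set.Ioc u (v + 1), Real.exp (-lam) * c / (v + 1 - u) ≤ orliczLevel Ψ lam n e := by
  have := isProbabilityMeasure_orliczMeasure hΨ hlam
  by_contra! hcon
  set μ := Measure.pi fun _ : Fin n => orliczMeasure Ψ lam
  have hlen : 0 < v + 1 - u := by linarith
  have hmeas : MeasurableSet {x : Fin n → ℝ | ∑ i, Ψ (x i) ∈ Set.Ioc u v} :=
    hΨ.measurable_sum n measurableSet_Ioc
  have hupper : ∫⁻ e in Set.Ioc u (v + 1), ENNReal.ofReal (orliczLevel Ψ lam n e) <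
      ENNReal.ofReal (Real.exp (-lam) * c) := by
    have hv : volume (Set.Ioc u (v + 1)) = ENNReal.ofReal (v + 1 - u) := Real.volume_Ioc
    calc _ < ∫⁻ _ in Set.Ioc u (v + 1), ENNReal.ofReal (Real.exp (-lam) * c / (v + 1 - u)) := by
          refine setLIntegral_strict_mono measurableSet_Ioc (by rw [hv]; simpa using hlen)
            measurable_const ?_ (ae_of_all _ fun e he => ?_)
          · refine ((setLIntegral_le_lintegral _ _).trans_lt ?_).ne
            rw [lintegral_orliczLevel hΨ hlam]
            exact ENNReal.ofReal_lt_top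
          · exact (ENNReal.ofReal_lt_ofReal_iff_of_nonneg
              (orliczLevel_nonneg hΨ hlam n e)).2 (hcon e he)
      _ = _ := by
          rw [setLIntegral_const, hv, ← ENNReal.ofReal_mul' hlen.le, div_mul_cancel₀ _ hlen.ne']
  have hlower : ENNReal.ofReal (Real.exp (-lam) * c) ≤
      ∫⁻ e in Set.Ioc u (v + 1), ENNReal.ofReal (orliczLevel Ψ lam n e) := by
    rw [setLIntegral_orliczLevel hΨ hlam]
    calc ENNReal.ofReal (Real.exp (-lam) * c)
        ≤ ENNReal.ofReal (Real.exp (-lam)) * μ {x : Fin n → ℝ | ∑ i, Ψ (x i) ∈ Set.Ioc u v} := by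
          rw [ENNReal.ofReal_mul (Real.exp_pos _).le]
          gcongr
          exact ENNReal.ofReal_le_of_le_toReal hc
      _ = ∫⁻ x in {x : Fin n → ℝ | ∑ i, Ψ (x i) ∈ Set.Ioc u v},
            ENNReal.ofReal (Real.exp (-lam)) ∂μ := by
          rw [setLIntegral_const]
      _ ≤ ∫⁻ x in {x : Fin n → ℝ | ∑ i, Ψ (x i) ∈ Set.Ioc u v},
            (∫⁻ e in Set.Ioc u (v + 1), expKernel lam (∑ i, Ψ (x i) - e)) ∂μ := by
          refine setLIntegral_mono' hmeas fun x hx => ?_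
          set s := ∑ i, Ψ (x i)
          have hx' : s ∈ Set.Ioc u v := hx
          calc ENNReal.ofReal (Real.exp (-lam))
              = ∫⁻ _ in Set.Icc s (s + 1), ENNReal.ofReal (Real.exp (-lam)) := by
                rw [setLIntegral_const, Real.volume_Icc]; simp
            _ ≤ ∫⁻ e in Set.Icc s (s + 1), expKernel lam (s - e) := by
                refine setLIntegral_mono' measurableSet_Icc fun e he => ?_
                rw [expKernel, Set.indicator_of_mem (by simpa using he.1)]
                gcongr
                nlinarith [he.2]
            _ ≤ _ := lintegral_mono_set
                (show Set.Icc s (s + 1) ⊆ Set.Ioc u (v + 1) from fun e he =>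
                ⟨hx'.1.trans_le he.1, he.2.trans (by linarith [hx'.2])⟩)
      _ ≤ _ := setLIntegral_le_lintegral _ _
  exact absurd hupper (not_lt.2 hlower)

end

/-! ### Slow variation of the normalized volume near its center -/

section
variable {Ψ : ℝ → ℝ} {lam : ℝ}

/-- The central limit theorem for `S = Ψ(X₁) + ⋯ + Ψ(Xₙ)`, in the weak form that every window of
width of order `√n` around `orliczMean Ψ lam * n` has probability bounded below. -/
theorem exists_le_measureReal_sum_mem_Ioo (hΨ : IsYoungFunction Ψ) (hlam : 0 < lam) {a b : ℝ}
    (hab : a < b) : ∃ c > 0, ∀ᶠ n : ℕ in atTop,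
      c ≤ (Measure.pi fun _ : Fin n => orliczMeasure Ψ lam).real {x : Fin n → ℝ |
        ∑ i, Ψ (x i) ∈ Set.Ioo (orliczMean Ψ lam * n + a * √n) (orliczMean Ψ lam * n + b * √n)} := by
  have hμ := isProbabilityMeasure_orliczMeasure hΨ hlam
  set μ := orliczMeasure Ψ lam with hμ_def
  have hΨm : Measurable Ψ := hΨ.continuous.measurable
  set P : Measure (ℕ → ℝ) := Measure.infinitePi fun _ => μ with hP
  set X : ℕ → (ℕ → ℝ) → ℝ := fun i ω => Ψ (ω i) with hX
  have hlaw : ∀ i, P.map (fun ω => ω i) = μ := fun i => Measure.infinitePi_map_eval _ i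
  have hXlaw : ∀ i, P.map (X i) = μ.map Ψ := fun i => by
    rw [← hlaw i, Measure.map_map hΨm (measurable_pi_apply i)]; rfl
  have hXm : ∀ i, Measurable (X i) := fun i => hΨm.comp (measurable_pi_apply i)
  have hident : ∀ i, IdentDistrib (X i) (X 0) P P := fun i =>
    ⟨(hXm i).aemeasurable, (hXm 0).aemeasurable, by rw [hXlaw, hXlaw]⟩
  have hident' : IdentDistrib (X 0) Ψ P μ :=
    ⟨(hXm 0).aemeasurable, hΨm.aemeasurable, hXlaw 0⟩
  have hindep : iIndepFun X P :=
    iIndepFun_infinitePi (X := fun _ => Ψ) (fun _ => hΨm)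
  have hmean : P[X 0] = orliczMean Ψ lam := hident'.integral_eq
  have hvar : Var[X 0; P] = variance Ψ μ := hident'.variance_eq
  have hclt := tendstoInDistribution_inv_sqrt_mul_sum_sub (P' := gaussianReal 0 Var[X 0; P].toNNReal)
    (Y := id) HasLaw.id (hident'.memLp_iff.2 (memLp_two_orliczMeasure hΨ hlam)) hindep hident
  have hliminf := ProbabilityMeasure.le_liminf_measure_open_of_tendsto hclt.tendsto
    (isOpen_Ioo (a := a) (b := b))
  simp only [ProbabilityMeasure.coe_mk, Measure.map_id] at hliminf
  have hv0 : Var[X 0; P].toNNReal ≠ 0 := by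
    rw [hvar]; exact (Real.toNNReal_pos.2 (variance_orliczMeasure_pos hΨ hlam)).ne'
  have hpos : 0 < gaussianReal 0 Var[X 0; P].toNNReal (Set.Ioo a b) := by
    rw [pos_iff_ne_zero]
    intro h0
    have := gaussianReal_absolutelyContinuous' 0 hv0 h0
    rw [Real.volume_Ioo, ENNReal.ofReal_eq_zero] at this
    linarith
  obtain ⟨c, hc0, hc⟩ := ENNReal.lt_iff_exists_nnreal_btwn.1 (hpos.trans_le hliminf)
  refine ⟨c, by exact_mod_cast hc0, ?_⟩
  filter_upwards [eventually_lt_of_lt_liminf hc, eventually_gt_atTop 0] with n hn hn0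
  have hsq : 0 < √(n : ℝ) := Real.sqrt_pos.2 (by exact_mod_cast hn0)
  -- the first `n` coordinates of the infinite product have the law `Measure.pi`
  have hfin : P.map (fun ω (i : Fin n) => ω i) = Measure.pi fun _ : Fin n => μ := by
    rw [← Measure.infinitePi_eq_pi]
    exact Measure.map_infinitePi_infinitePi_of_inj (P := fun _ : ℕ => μ) Fin.val_injective
  rw [Measure.map_apply_of_aemeasurable (hclt.forall_aemeasurable n) measurableSet_Ioo] at hn
  have hmeas : MeasurableSet {x : Fin n → ℝ | ∑ i, Ψ (x i) ∈
      Set.Ioo (orliczMean Ψ lam * n + a * √n) (orliczMean Ψ lam * n + b * √n)} :=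
    hΨ.measurable_sum n measurableSet_Ioo
  rw [← hfin, map_measureReal_apply (by fun_prop) hmeas]
  have hset : (fun ω => (√(n : ℝ))⁻¹ * (∑ k ∈ Finset.range n, X k ω - n * P[X 0])) ⁻¹' Set.Ioo a b =
      (fun ω (i : Fin n) => ω i) ⁻¹' {x : Fin n → ℝ | ∑ i, Ψ (x i) ∈
        Set.Ioo (orliczMean Ψ lam * n + a * √n) (orliczMean Ψ lam * n + b * √n)} := by
    rw [hmean]
    ext ω
    simp only [Set.mem_preimage, Set.mem_ofPred_eq, Set.mem_Ioo, hX]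
    rw [← Fin.sum_univ_eq_sum_range (fun k => Ψ (ω k)) n, ← div_eq_inv_mul, lt_div_iff₀ hsq,
      div_lt_iff₀ hsq]
    constructor <;> rintro ⟨h1, h2⟩ <;> constructor <;> linarith
  rw [hset] at hn
  exact ENNReal.toReal_mono (measure_ne_top P _) hn.le

/-- In every window of width of order `√n` around `orliczMean Ψ lam * n` the log-concave function
`orliczLevel` is comparable to its supremum. -/
theorem exists_orliczLevel_le_mul (hΨ : IsYoungFunction Ψ) (hlam : 0 < lam) {C : ℝ} (hC : 1 ≤ C) :
    ∃ D, 1 ≤ D ∧ ∀ᶠ n : ℕ in atTop, ∀ e, |e - orliczMean Ψ lam * n| ≤ C * √n →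
      0 < orliczLevel Ψ lam n e ∧ ∀ x, orliczLevel Ψ lam n x ≤ D * orliczLevel Ψ lam n e := by
  obtain ⟨c₁, hc₁, h₁⟩ := exists_le_measureReal_sum_mem_Ioo hΨ hlam
    (a := -(C + 2)) (b := -(C + 1)) (by linarith)
  obtain ⟨c₂, hc₂, h₂⟩ := exists_le_measureReal_sum_mem_Ioo hΨ hlam
    (a := C) (b := C + 1) (by linarith)
  set κ := Real.exp (-lam) * min c₁ c₂ / 2 with hκ
  have hκ0 : 0 < κ := by have := lt_min hc₁ hc₂; positivity
  refine ⟨max 1 (4 / (lam * κ) ^ 2), le_max_left _ _, ?_⟩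
  filter_upwards [h₁, h₂, eventually_ge_atTop 1] with n hn₁ hn₂ hn e he
  have := isProbabilityMeasure_orliczMeasure hΨ hlam
  have hs : 1 ≤ √(n : ℝ) := Real.one_le_sqrt.2 (by exact_mod_cast hn)
  set r := √(n : ℝ)
  set m := orliczMean Ψ lam * n
  have hlc := isLogConcave_orliczLevel hΨ hlam n
  -- some value of order `1 / √n` in each of the windows `m + [a r, (a + 1) r + 1]` below
  have hpoint : ∀ a c, min c₁ c₂ ≤ c → c ≤ (Measure.pi fun _ : Fin n => orliczMeasure Ψ lam).real
      {x : Fin n → ℝ | ∑ i, Ψ (x i) ∈ Set.Ioo (m + a * r) (m + (a + 1) * r)} →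
      ∃ p ∈ Set.Ioc (m + a * r) (m + (a + 1) * r + 1), κ / r ≤ orliczLevel Ψ lam n p := by
    intro a c hcmin hc
    obtain ⟨p, hp, hle⟩ := exists_le_orliczLevel hΨ hlam n (u := m + a * r)
      (v := m + (a + 1) * r) (c := c) (by linarith) (hc.trans (measureReal_mono
        fun x (hx : _ ∈ Set.Ioo _ _) => Set.Ioo_subset_Ioc_self hx))
    refine ⟨p, hp, le_trans ?_ hle⟩
    have hmin := lt_min hc₁ hc₂
    calc κ / r = Real.exp (-lam) * min c₁ c₂ / (2 * r) := by rw [hκ]; field_simp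
      _ ≤ Real.exp (-lam) * c / (m + (a + 1) * r + 1 - (m + a * r)) := by
        have hc0 : 0 < c := hmin.trans_le hcmin
        gcongr
        · linarith
        · linarith
  -- `p` and `q` lie on either side of the window `m ± C r`
  obtain ⟨p, hp, hpl⟩ := hpoint (-(C + 2)) c₁ (min_le_left _ _)
    (by convert hn₁ using 7; ring)
  obtain ⟨q, hq, hql⟩ := hpoint C c₂ (min_le_right _ _) hn₂
  have hl0 : 0 < κ / r := by positivity
  have hlow : ∀ y, |y - m| ≤ C * r → κ / r ≤ orliczLevel Ψ lam n y := fun y hy => by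
    rw [abs_le] at hy
    exact hlc.le_of_mem_Icc hl0.le hpl hql ⟨by linarith [hp.2], by linarith [hq.1]⟩
  have he0 := hlow e he
  refine ⟨hl0.trans_le he0, fun x => ?_⟩
  have hsup := hlc.mul_le_of_lintegral_le (a := m) (w := r) (l := κ / r) (J := 1 / lam)
    (by linarith) hl0.le (by positivity) (fun y hy => hlow y (by
      rw [abs_le]; constructor <;> nlinarith [hy.1, hy.2])) (lintegral_orliczLevel hΨ hlam n).le x
  have h3 : orliczLevel Ψ lam n x ≤ 4 / (lam * κ) ^ 2 * (κ / r) := by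
    have hr : 0 < r := by linarith
    have h4 : orliczLevel Ψ lam n x * (κ / r) * r ^ 2 = orliczLevel Ψ lam n x * (κ * r) := by
      field_simp
    rw [h4] at hsup
    rw [show 4 / (lam * κ) ^ 2 * (κ / r) = 4 * (1 / lam) ^ 2 / (κ * r) by field_simp,
      le_div_iff₀ (by positivity)]
    exact hsup
  exact h3.trans (mul_le_mul (le_max_right _ _) he0 hl0.le (by positivity))

/-- Within windows of width of order `√n`, increments of order `o(√n)` of the level change
`orliczLevel` by a factor `1 + o(1)` only. -/
theorem exists_orliczLevel_le_rpow_mul (hΨ : IsYoungFunction Ψ) (hlam : 0 < lam) {C : ℝ}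
    (hC : 1 ≤ C) : ∃ D, 1 ≤ D ∧ ∀ᶠ n : ℕ in atTop, ∀ e, |e - orliczMean Ψ lam * n| ≤ C * √n →
      0 < orliczLevel Ψ lam n e ∧ ∀ x, orliczLevel Ψ lam n x ≤ D * orliczLevel Ψ lam n e ∧
        orliczLevel Ψ lam n x ≤ D ^ (|x - e| / √n) * orliczLevel Ψ lam n e := by
  obtain ⟨D, hD, h⟩ := exists_orliczLevel_le_mul hΨ hlam (C := C + 1) (by linarith)
  refine ⟨D, hD, ?_⟩
  filter_upwards [h, eventually_gt_atTop 0] with n hn hn0 e he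
  have hs : 0 < √(n : ℝ) := Real.sqrt_pos.2 (by exact_mod_cast hn0)
  have he' := hn e (he.trans (by nlinarith))
  refine ⟨he'.1, fun x => ⟨he'.2 x, ?_⟩⟩
  refine (isLogConcave_orliczLevel hΨ hlam n).le_rpow_mul hs hD he'.1 fun q hq => ?_
  have hq' := hn q (by
    calc |q - orliczMean Ψ lam * n| ≤ |q - e| + |e - orliczMean Ψ lam * n| := abs_sub_le _ _ _
      _ ≤ √n + C * √n := by rw [hq]; gcongr
      _ = (C + 1) * √n := by ring)
  exact ⟨hq'.1, hq'.2 e⟩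
end

/-! ### Total variation distance and densities -/

theorem tvDist_nonneg {X : Type*} [MeasurableSpace X] (μ ν : Measure X) : 0 ≤ tvDist μ ν :=
  Real.iSup_nonneg fun _ => abs_nonneg _

/-- For probability measures a one-sided comparison on all measurable sets is enough, since one can
pass to complements. -/
theorem tvDist_le_of_measureReal_le {X : Type*} [MeasurableSpace X] {μ ν : Measure X}
    [IsProbabilityMeasure μ] [IsProbabilityMeasure ν] {ε : ℝ}
    (h : ∀ A, MeasurableSet A → ν.real A ≤ μ.real A + ε) : tvDist μ ν ≤ ε := by
  have : Nonempty {A : Set X // MeasurableSet A} := ⟨⟨∅, .empty⟩⟩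
  refine ciSup_le fun ⟨A, hA⟩ => abs_le.2 ⟨by linarith [h A hA], ?_⟩
  have hc := h Aᶜ hA.compl
  rw [probReal_compl_eq_one_sub hA, probReal_compl_eq_one_sub hA] at hc
  linarith

/-- If `ν` has density proportional to `w` with respect to `μ`, and `w` is at least
`(1 + η)⁻¹` times its mean on a set `G` of `μ`-measure at least `1 - δ`, then `ν` dominates `μ` up
to `η + δ`. -/
theorem measureReal_le_add_of_density {X : Type*} [MeasurableSpace X] {μ ν : Measure X}
    [IsProbabilityMeasure μ] [IsProbabilityMeasure ν] {w : X → ENNReal} {G : Set X} {η δ : ℝ}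
    (hη : 0 ≤ η) (hG : MeasurableSet G) (hGδ : μ.real Gᶜ ≤ δ)
    (hw0 : ∫⁻ x, w x ∂μ ≠ 0) (hw1 : ∫⁻ x, w x ∂μ ≠ ⊤)
    (hν : ∀ A, MeasurableSet A → ν A * ∫⁻ x, w x ∂μ = ∫⁻ x in A, w x ∂μ)
    (hle : ∀ x ∈ G, ∫⁻ x, w x ∂μ ≤ ENNReal.ofReal (1 + η) * w x)
    {A : Set X} (hA : MeasurableSet A) : μ.real A ≤ ν.real A + (η + δ) := by
  set I := ∫⁻ x, w x ∂μ
  have h1 : μ (A ∩ G) * I ≤ ENNReal.ofReal (1 + η) * ν A * I := by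
    calc μ (A ∩ G) * I = ∫⁻ _ in A ∩ G, I ∂μ := by rw [setLIntegral_const, mul_comm]
      _ ≤ ∫⁻ x in A ∩ G, ENNReal.ofReal (1 + η) * w x ∂μ :=
        setLIntegral_mono' (hA.inter hG) fun x hx => hle x hx.2
      _ = ENNReal.ofReal (1 + η) * ∫⁻ x in A ∩ G, w x ∂μ :=
        lintegral_const_mul' _ _ ENNReal.ofReal_ne_top
      _ ≤ ENNReal.ofReal (1 + η) * ∫⁻ x in A, w x ∂μ := by
        gcongr
        exact Set.inter_subset_left
      _ = _ := by rw [← hν A hA, mul_assoc]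
  have h2 : μ.real (A ∩ G) ≤ (1 + η) * ν.real A := by
    have h3 := ENNReal.toReal_mono (ENNReal.mul_ne_top ENNReal.ofReal_ne_top (measure_ne_top ν A))
      ((ENNReal.mul_le_mul_iff_left hw0 hw1).1 h1)
    rwa [ENNReal.toReal_mul, ENNReal.toReal_ofReal (by linarith)] at h3
  have h4 : μ.real A ≤ μ.real (A ∩ G) + μ.real Gᶜ :=
    (measureReal_mono fun x hx => (em (x ∈ G)).imp (fun h => ⟨hx, h⟩) id).trans
      (measureReal_union_le _ _)
  have h5 : ν.real A ≤ 1 := measureReal_le_one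
  nlinarith

/-! ### The law of the first coordinates of a uniform point -/

theorem measurePreserving_finAppend {X : Type*} [MeasurableSpace X] (ν : Measure X) [SigmaFinite ν]
    (k m : ℕ) : MeasurePreserving (fun p : (Fin k → X) × (Fin m → X) => Fin.append p.1 p.2)
      ((Measure.pi fun _ => ν).prod (Measure.pi fun _ => ν)) (Measure.pi fun _ => ν) := by
  have hm : Measurable fun p : (Fin k → X) × (Fin m → X) => Fin.append p.1 p.2 := by
    refine measurable_pi_lambda _ fun i => ?_
    refine Fin.addCases (fun j => ?_) (fun j => ?_) i
    · simpa using! (measurable_pi_apply j).comp measurable_fst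
    · simpa using! (measurable_pi_apply j).comp measurable_snd
  refine ⟨hm, (Measure.pi_eq fun s hs => ?_).symm⟩
  have hpre : (fun p : (Fin k → X) × (Fin m → X) => Fin.append p.1 p.2) ⁻¹' Set.univ.pi s =
      (Set.univ.pi fun i => s (Fin.castAdd m i)) ×ˢ (Set.univ.pi fun i => s (Fin.natAdd k i)) := by
    ext p
    simp only [Set.mem_preimage, Set.mem_pi, Set.mem_univ, true_imp_iff, Set.mem_prod]
    refine ⟨fun h => ⟨fun i => by simpa using h (Fin.castAdd m i),
      fun i => by simpa using h (Fin.natAdd k i)⟩, fun h i => ?_⟩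
    refine Fin.addCases (fun j => ?_) (fun j => ?_) i
    · simpa using h.1 j
    · simpa using h.2 j
  rw [Measure.map_apply hm (MeasurableSet.univ_pi hs), hpre, Measure.prod_prod, Measure.pi_pi,
    Measure.pi_pi, Fin.prod_univ_add]

theorem measurable_firstCoords {n : ℕ} (k : ℕ) :
    Measurable (firstCoords k : (Fin n → ℝ) → Fin k → ℝ) := by
  refine measurable_pi_lambda _ fun i => ?_
  unfold firstCoords
  by_cases h : (i : ℕ) < n
  · simpa [h] using measurable_pi_apply _
  · simp [h]

section
variable {Ψ : ℝ → ℝ} {lam : ℝ}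

/-- The volume of the part of the Orlicz ball whose first `k` coordinates lie in `A`, by
integration over the other `m` coordinates. -/
theorem volume_firstCoords_preimage_inter (hΨ : IsYoungFunction Ψ) (hlam : 0 < lam) (k m : ℕ)
    (e : ℝ) {A : Set (Fin k → ℝ)} (hA : MeasurableSet A) :
    volume ((firstCoords k : (Fin (k + m) → ℝ) → Fin k → ℝ) ⁻¹' A ∩ orliczBall Ψ e (k + m))
        * ENNReal.ofReal (Real.exp (-lam * e) / orliczZ Ψ lam ^ (k + m)) =
      ∫⁻ y in A, ENNReal.ofReal (orliczLevel Ψ lam m (e - ∑ i, Ψ (y i)))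
        ∂(Measure.pi fun _ : Fin k => orliczMeasure Ψ lam) := by
  have := isProbabilityMeasure_orliczMeasure hΨ hlam
  have hA' := measurable_firstCoords (n := k + m) k hA
  have hmp := measurePreserving_finAppend (orliczMeasure Ψ lam) k m
  have hk : Measurable fun x : Fin (k + m) → ℝ => expKernel lam (∑ i, Ψ (x i) - e) :=
    (measurable_expKernel lam).comp ((hΨ.measurable_sum _).sub_const e)
  rw [volume_inter_orliczBall hΨ hlam _ _ hA', ← hmp.setLIntegral_comp_preimage hA' hk]
  have hpre : (fun p : (Fin k → ℝ) × (Fin m → ℝ) => Fin.append p.1 p.2) ⁻¹'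
      ((firstCoords k : (Fin (k + m) → ℝ) → Fin k → ℝ) ⁻¹' A) = A ×ˢ Set.univ := by
    ext p
    have : firstCoords k (Fin.append p.1 p.2) = p.1 := by
      ext i
      have hi : (i : ℕ) < k + m := i.2.trans_le (Nat.le_add_right _ _)
      rw [firstCoords, dif_pos hi]
      exact Fin.append_left p.1 p.2 i
    simp [this]
  have hk' : Measurable fun p : (Fin k → ℝ) × (Fin m → ℝ) =>
      expKernel lam (∑ i, Ψ (Fin.append p.1 p.2 i) - e) := hk.comp hmp.measurable
  rw [hpre, setLIntegral_prod _ hk'.aemeasurable]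
  refine lintegral_congr fun y => ?_
  rw [setLIntegral_univ, ofReal_orliczLevel hΨ hlam]
  refine lintegral_congr fun z => ?_
  congr 1
  simp only [Fin.sum_univ_add, Fin.append_left, Fin.append_right]
  ring

theorem orliczMean_nonneg (hΨ : IsYoungFunction Ψ) (lam : ℝ) : 0 ≤ orliczMean Ψ lam :=
  integral_nonneg hΨ.nonneg

/-- Markov's inequality for `Ψ(X₁) + ⋯ + Ψ(X_k)`; the threshold `R (k + 1)` rather than `R k`
keeps the bound uniform in `k`, including `k = 0`. -/
theorem measureReal_sum_gt_le (hΨ : IsYoungFunction Ψ) (hlam : 0 < lam) (k : ℕ) {R : ℝ}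
    (hR : 0 < R) : (Measure.pi fun _ : Fin k => orliczMeasure Ψ lam).real
      {y : Fin k → ℝ | ∑ i, Ψ (y i) ≤ R * (k + 1)}ᶜ ≤ orliczMean Ψ lam / R := by
  have := isProbabilityMeasure_orliczMeasure hΨ hlam
  set μ := Measure.pi fun _ : Fin k => orliczMeasure Ψ lam
  have hΨm := hΨ.continuous.measurable
  have hΨi : Integrable Ψ (orliczMeasure Ψ lam) :=
    (memLp_two_orliczMeasure hΨ hlam).integrable (by norm_num)
  have hi : ∀ i, Integrable (fun y : Fin k → ℝ => Ψ (y i)) μ := fun i =>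
    (measurePreserving_eval (fun _ : Fin k => orliczMeasure Ψ lam) i).integrable_comp_of_integrable
      hΨi
  have hint : ∫ y, ∑ i, Ψ (y i) ∂μ = k * orliczMean Ψ lam := by
    rw [integral_finsetSum _ fun i _ => hi i]
    have : ∀ i : Fin k, ∫ y, Ψ (y i) ∂μ = orliczMean Ψ lam := fun i => by
      have hmp := measurePreserving_eval (fun _ : Fin k => orliczMeasure Ψ lam) i
      rw [orliczMean, ← hmp.map_eq, integral_map hmp.measurable.aemeasurable
        hΨm.aestronglyMeasurable]
    simp [this]
  have hmarkov := mul_meas_ge_le_integral_of_nonneg (μ := μ)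
    (f := fun y : Fin k → ℝ => ∑ i, Ψ (y i))
    (ae_of_all _ fun y : Fin k → ℝ => Finset.sum_nonneg fun i _ => hΨ.nonneg (y i))
    (integrable_finsetSum _ fun i _ => hi i) (R * (k + 1))
  rw [hint] at hmarkov
  have hm := orliczMean_nonneg hΨ lam
  have hle : μ.real {y : Fin k → ℝ | ∑ i, Ψ (y i) ≤ R * (k + 1)}ᶜ ≤
      μ.real {y : Fin k → ℝ | R * (k + 1) ≤ ∑ i, Ψ (y i)} :=
    measureReal_mono fun y hy => (not_le.1 (show ¬ ∑ i, Ψ (y i) ≤ R * (k + 1) from hy)).le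
  have hk : (0 : ℝ) < k + 1 := by positivity
  rw [le_div_iff₀ hR]
  refine le_of_mul_le_mul_right ?_ hk
  calc _ = R * (k + 1) * μ.real {y : Fin k → ℝ | ∑ i, Ψ (y i) ≤ R * (k + 1)}ᶜ := by ring
    _ ≤ R * (k + 1) * μ.real {y : Fin k → ℝ | R * (k + 1) ≤ ∑ i, Ψ (y i)} := by gcongr
    _ ≤ k * orliczMean Ψ lam := hmarkov
    _ ≤ orliczMean Ψ lam * (k + 1) := by linarith

/-- The density of the first `k` coordinates of a uniform point of the Orlicz ball is, up to
normalization, `y ↦ orliczLevel Ψ lam m (e - ∑ Ψ(yᵢ))`; if this function varies little on the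
typical set `∑ Ψ(yᵢ) ≤ R (k + 1)`, and is comparable to its supremum there, then the law of these
coordinates is close to the product measure. -/
theorem tvDist_firstCoords_le (hΨ : IsYoungFunction Ψ) (hlam : 0 < lam) {n k m : ℕ}
    (hn : n = k + m) {e D R ρ : ℝ} (hR : 0 < R) (hD : 0 ≤ D) (hρ : 1 ≤ ρ)
    (hlevel : ∀ s, 0 ≤ s → s ≤ R * (k + 1) → 0 < orliczLevel Ψ lam m (e - s) ∧
      (∀ x, orliczLevel Ψ lam m x ≤ D * orliczLevel Ψ lam m (e - s)) ∧
      ∀ s', 0 ≤ s' → s' ≤ R * (k + 1) →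
        orliczLevel Ψ lam m (e - s') ≤ ρ * orliczLevel Ψ lam m (e - s))
    {Ω : Type*} [MeasurableSpace Ω] (P : Measure Ω) [IsProbabilityMeasure P]
    (ξ : Ω → Fin n → ℝ) (hξ : pdf.IsUniform ξ (orliczBall Ψ e n) P volume) :
    tvDist (P.map fun ω => firstCoords k (ξ ω)) (Measure.pi fun _ : Fin k => orliczMeasure Ψ lam)
      ≤ (ρ - 1) + (D + 1) * (orliczMean Ψ lam / R) := by
  subst hn
  have := isProbabilityMeasure_orliczMeasure hΨ hlam
  set μ := Measure.pi fun _ : Fin k => orliczMeasure Ψ lam with hμ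
  have hT : 0 < R * (k + 1) := by positivity
  have he : 0 < e := by
    by_contra hneg
    have h := (hlevel _ hT.le le_rfl).1
    rw [orliczLevel, hΨ.orliczVolume_of_neg m (by linarith), zero_mul] at h
    exact lt_irrefl _ h
  have hball0 : volume (orliczBall Ψ e (k + m)) ≠ 0 := by
    rw [← hΨ.ofReal_orliczVolume]
    exact (ENNReal.ofReal_pos.2 (hΨ.orliczVolume_pos _ he)).ne'
  have hball1 := (hΨ.volume_orliczBall_lt_top e (k + m)).ne
  have hξm := hξ.aemeasurable hball0 hball1
  have hfm := measurable_firstCoords (n := k + m) k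
  have hmap : (P.map fun ω => firstCoords k (ξ ω)) = (P.map ξ).map (firstCoords k) :=
    (AEMeasurable.map_map_of_aemeasurable hfm.aemeasurable hξm).symm
  have hprob : IsProbabilityMeasure (P.map fun ω => firstCoords k (ξ ω)) :=
    Measure.isProbabilityMeasure_map (hfm.comp_aemeasurable hξm)
  set w : (Fin k → ℝ) → ENNReal := fun y =>
    ENNReal.ofReal (orliczLevel Ψ lam m (e - ∑ i, Ψ (y i))) with hw
  have hvol := fun A hA => volume_firstCoords_preimage_inter hΨ hlam k m e (A := A) hA
  have hc0 : 0 < Real.exp (-lam * e) / orliczZ Ψ lam ^ (k + m) :=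
    div_pos (Real.exp_pos _) (pow_pos (orliczZ_pos hΨ hlam) _)
  have hI : ∫⁻ y, w y ∂μ = volume (orliczBall Ψ e (k + m))
      * ENNReal.ofReal (Real.exp (-lam * e) / orliczZ Ψ lam ^ (k + m)) := by
    rw [← setLIntegral_univ, ← hvol _ .univ, Set.preimage_univ, Set.univ_inter]
  have hG : MeasurableSet {y : Fin k → ℝ | ∑ i, Ψ (y i) ≤ R * (k + 1)} :=
    measurableSet_le (hΨ.measurable_sum k) measurable_const
  have hmarkov := measureReal_sum_gt_le hΨ hlam k hR
  set G := {y : Fin k → ℝ | ∑ i, Ψ (y i) ≤ R * (k + 1)} with hGdef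
  have hδ : 0 ≤ orliczMean Ψ lam / R := div_nonneg (orliczMean_nonneg hΨ lam) hR.le
  set δ := orliczMean Ψ lam / R
  have hs0 : ∀ y : Fin k → ℝ, 0 ≤ ∑ i, Ψ (y i) := fun y => Finset.sum_nonneg fun i _ => hΨ.nonneg _
  refine tvDist_le_of_measureReal_le fun A hA => ?_
  have key := measureReal_le_add_of_density (μ := μ)
    (ν := P.map fun ω => firstCoords k (ξ ω)) (w := w) (G := G) (η := (ρ - 1) + D * δ) (δ := δ)
    (add_nonneg (by linarith) (mul_nonneg hD hδ)) hG hmarkov ?_ ?_ ?_ ?_ hA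
  · linarith
  · rw [hI]
    exact mul_ne_zero hball0 (ENNReal.ofReal_pos.2 hc0).ne'
  · rw [hI]
    exact ENNReal.mul_ne_top hball1 ENNReal.ofReal_ne_top
  · intro B hB
    rw [← hvol B hB, hI, hmap, Measure.map_apply hfm hB, hξ,
      cond_apply (hΨ.measurableSet_orliczBall _ _), ← mul_assoc, mul_comm (_ * _) (volume _),
      ← mul_assoc, ENNReal.mul_inv_cancel hball0 hball1, one_mul, Set.inter_comm]
  · intro y hy
    obtain ⟨-, hsup, hloc⟩ := hlevel _ (hs0 y) hy
    have hnn := orliczLevel_nonneg hΨ hlam m (e - ∑ i, Ψ (y i))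
    calc ∫⁻ z, w z ∂μ = ∫⁻ z in G, w z ∂μ + ∫⁻ z in Gᶜ, w z ∂μ := (lintegral_add_compl _ hG).symm
      _ ≤ ∫⁻ _ in G, ENNReal.ofReal ρ * w y ∂μ + ∫⁻ _ in Gᶜ, ENNReal.ofReal D * w y ∂μ := by
        refine add_le_add (setLIntegral_mono' hG fun z hz => ?_)
          (setLIntegral_mono' hG.compl fun z hz => ?_)
        · rw [hw, ← ENNReal.ofReal_mul (by linarith)]
          exact ENNReal.ofReal_le_ofReal (hloc _ (hs0 z) hz)
        · rw [hw, ← ENNReal.ofReal_mul hD]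
          exact ENNReal.ofReal_le_ofReal (hsup _)
      _ ≤ ENNReal.ofReal ρ * w y * 1 + ENNReal.ofReal D * w y * ENNReal.ofReal δ := by
        rw [setLIntegral_const, setLIntegral_const]
        gcongr
        · exact prob_le_one
        · rw [← ofReal_measureReal]
          exact ENNReal.ofReal_le_ofReal hmarkov
      _ = ENNReal.ofReal (1 + (ρ - 1 + D * δ)) * w y := by
        rw [show 1 + (ρ - 1 + D * δ) = ρ + D * δ by ring,
          ENNReal.ofReal_add (by linarith) (by positivity), ENNReal.ofReal_mul hD]
        ring

end

/-! ### Convergence in total variation -/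

theorem mainTheorem4
    (Ψ : ℝ → ℝ) (hΨ : IsYoungFunction Ψ) (lam : ℝ) (hlam : 0 < lam)
    (α : ℕ → ℝ) (hα : ∃ C : ℝ, ∀ n, 1 ≤ n → |α n| ≤ C)
    (E : ℕ → ℝ)
    (hE : ∀ n, 1 ≤ n → E n = orliczMean Ψ lam * n + α n * orliczSigma Ψ lam * √(n : ℝ))
    {Ω : ℕ → Type*} [∀ n, MeasurableSpace (Ω n)]
    (P : ∀ n, Measure (Ω n)) [∀ n, IsProbabilityMeasure (P n)]
    (ξ : ∀ n, Ω n → (Fin n → ℝ))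
    (hξ : ∀ᶠ n in atTop, pdf.IsUniform (ξ n) (orliczBall Ψ (E n) n) (P n) volume)
    (k : ℕ → ℕ) (hk : (fun n => (k n : ℝ)) =o[atTop] fun n => √(n : ℝ)) :
    Tendsto
      (fun n => tvDist
        ((P n).map fun ω => firstCoords (k n) (ξ n ω))
        (Measure.pi fun _ : Fin (k n) => orliczMeasure Ψ lam))
      atTop (𝓝 0) := by
  refine tendsto_order.2 ⟨fun a ha => .of_forall fun n => ha.trans_le (tvDist_nonneg _ _),
    fun ε hε => ?_⟩
  obtain ⟨C₀, hC₀⟩ := hα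
  have hC₀0 : 0 ≤ C₀ := (abs_nonneg _).trans (hC₀ 1 le_rfl)
  have hσ : 0 ≤ orliczSigma Ψ lam := Real.sqrt_nonneg _
  have hm := orliczMean_nonneg hΨ lam
  set σ := orliczSigma Ψ lam
  set M := orliczMean Ψ lam
  obtain ⟨D, hD, hlevel⟩ := exists_orliczLevel_le_rpow_mul hΨ hlam (C := 2 * (C₀ * σ) + 1)
    (by nlinarith [mul_nonneg hC₀0 hσ])
  -- `R` makes the contribution of the atypical set small, `x₀` that of the increments of the level
  obtain ⟨R, hR, hRε⟩ : ∃ R > 0, (D + 1) * (M / R) ≤ ε / 4 := by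
    refine ⟨4 * (D + 1) * (M + 1) / ε, by positivity, ?_⟩
    have h : (D + 1) * (M / (4 * (D + 1) * (M + 1) / ε)) = ε / 4 * (M / (M + 1)) := by
      field_simp
    rw [h]
    exact mul_le_of_le_one_right (by positivity) ((div_le_one (by positivity)).2 (by linarith))
  obtain ⟨x₀, hx₀, hDx₀⟩ : ∃ x₀ : ℝ, 0 < x₀ ∧ D ^ x₀ ≤ 1 + ε / 2 := by
    have hlogD := Real.log_nonneg hD
    have hlog : 0 < Real.log (1 + ε / 2) := Real.log_pos (by linarith)
    refine ⟨Real.log (1 + ε / 2) / (Real.log D + 1), by positivity, ?_⟩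
    rw [Real.rpow_def_of_pos (by linarith), ← Real.le_log_iff_exp_le (by positivity),
      mul_div_assoc', div_le_iff₀ (by positivity)]
    nlinarith
  -- `k n + 1 = o(√n)`
  have hk1 : (fun n => (k n : ℝ) + 1) =o[atTop] fun n : ℕ => √(n : ℝ) := by
    refine hk.add ?_
    refine (isLittleO_const_left.2 (.inr ?_))
    exact tendsto_norm_atTop_atTop.comp
      (Real.tendsto_sqrt_atTop.comp tendsto_natCast_atTop_atTop)
  have hθ : 0 < min (1 / 2) (min (1 / (2 * (M + R))) (x₀ / (2 * R))) := by positivity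
  have hsmall := hk1.def hθ
  -- in particular `n - k n` is at least `n / 2`, and so tends to infinity
  have hkhalf : ∀ᶠ n : ℕ in atTop, (k n : ℝ) ≤ n / 2 := by
    filter_upwards [hsmall, eventually_ge_atTop 1] with n hkn hn1
    rw [Real.norm_of_nonneg (by positivity), Real.norm_of_nonneg (Real.sqrt_nonneg _)] at hkn
    have h1 : √(n : ℝ) ≤ n := by
      have : (1 : ℝ) ≤ n := by exact_mod_cast hn1
      exact Real.sqrt_le_iff.2 ⟨by linarith, by nlinarith⟩
    have h2 := hkn.trans (mul_le_mul_of_nonneg_right (min_le_left _ _) (Real.sqrt_nonneg _))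
    linarith
  have hN : Tendsto (fun n => n - k n) atTop atTop := by
    rw [← tendsto_natCast_atTop_iff (R := ℝ)]
    refine tendsto_atTop_mono' _ ?_
      (tendsto_natCast_atTop_atTop.atTop_div_const (two_pos : (0 : ℝ) < 2))
    filter_upwards [hkhalf] with n hn
    have hle : k n ≤ n := by
      have : (k n : ℝ) ≤ n := by linarith [(Nat.cast_nonneg n : (0 : ℝ) ≤ n)]
      exact_mod_cast this
    rw [Nat.cast_sub hle]
    linarith
  filter_upwards [hξ, hsmall, hkhalf, hN.eventually hlevel, eventually_ge_atTop 1]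
    with n hn hkn hkn' hlev hn1
  have hle : k n ≤ n := by
    have : (k n : ℝ) ≤ n := by linarith [(Nat.cast_nonneg n : (0 : ℝ) ≤ n)]
    exact_mod_cast this
  set m := n - k n
  have hnkm : n = k n + m := by omega
  have hncast : (n : ℝ) = k n + m := by exact_mod_cast hnkm
  set r := √(n : ℝ) with hr
  have hr0 : 0 ≤ r := Real.sqrt_nonneg _
  have hr1 : 1 ≤ r := Real.one_le_sqrt.2 (by exact_mod_cast hn1)
  have hmr : r / 2 ≤ √(m : ℝ) := by
    refine Real.le_sqrt_of_sq_le ?_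
    rw [div_pow, hr, Real.sq_sqrt (Nat.cast_nonneg _)]
    linarith
  rw [Real.norm_of_nonneg (by positivity), Real.norm_of_nonneg hr0] at hkn
  have hk₁ : (M + R) * (k n + 1) ≤ r / 2 := by
    have h := hkn.trans (mul_le_mul_of_nonneg_right ((min_le_right _ _).trans (min_le_left _ _)) hr0)
    rw [div_mul_eq_mul_div, one_mul, le_div_iff₀ (by positivity)] at h
    linarith
  have hk₂ : R * (k n + 1) ≤ x₀ * (r / 2) := by
    have h := hkn.trans (mul_le_mul_of_nonneg_right ((min_le_right _ _).trans (min_le_right _ _)) hr0)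
    rw [div_mul_eq_mul_div, le_div_iff₀ (by positivity)] at h
    linarith
  -- `E n - s = M * m + α n * σ * √n + (M * k n - s)`, where the last term is `o(√n)`
  have hwindow : ∀ s, 0 ≤ s → s ≤ R * (k n + 1) →
      |E n - s - M * m| ≤ (2 * (C₀ * σ) + 1) * √(m : ℝ) := fun s hs0 hs => by
    have hα' : |α n * σ * r| ≤ C₀ * σ * r := by
      rw [abs_mul, abs_mul, abs_of_nonneg hσ, abs_of_nonneg hr0]
      gcongr
      exact hC₀ n hn1
    have hkM : 0 ≤ M * k n := by positivity
    have hC₀σ : 0 ≤ C₀ * σ := mul_nonneg hC₀0 hσ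
    have hgap : E n - s - M * m = α n * σ * r + (M * k n - s) := by
      rw [hE n hn1, ← hr, hncast]; ring
    have hgap' : |M * k n - s| ≤ r / 2 := by
      rw [abs_le]; constructor <;> nlinarith
    calc |E n - s - M * m| ≤ |α n * σ * r| + |M * k n - s| := hgap ▸ abs_add_le _ _
      _ ≤ C₀ * σ * r + r / 2 := add_le_add hα' hgap'
      _ = (2 * (C₀ * σ) + 1) * (r / 2) := by ring
      _ ≤ _ := by gcongr
  have htv := tvDist_firstCoords_le hΨ hlam hnkm (e := E n) (D := D) (R := R) (ρ := 1 + ε / 2) hR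
    (by linarith) (by linarith) (fun s hs0 hs => by
      obtain ⟨hpos, hcomp⟩ := hlev _ (hwindow s hs0 hs)
      refine ⟨hpos, fun x => (hcomp x).1, fun s' hs'0 hs' => (hcomp _).2.trans ?_⟩
      gcongr
      refine le_trans (Real.rpow_le_rpow_of_exponent_le hD ?_) hDx₀
      rw [div_le_iff₀ (by linarith)]
      calc |E n - s' - (E n - s)| ≤ R * (k n + 1) := by
            rw [abs_le]; constructor <;> linarith
        _ ≤ x₀ * (r / 2) := hk₂
        _ ≤ x₀ * √(m : ℝ) := by gcongr) (P n) (ξ n) hn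
  linarith
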